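/- Let $m$ be normalized Lebesgue measure on the unit circle $\mathbb{T}$, let $\mathbb{D}$ be the open unit disc, and let $H^2$ be the Hardy space of holomorphic functions $f(z)=\sum_{n\ge 0}a_nz^n$ on $\mathbb{D}$ with $\|f\|^2=\sum_{n\ge0}|a_n|^2<\infty$. A function $\varphi\in H^2$ is inner if for $m$-almost every $\omega\in\mathbb{T}$ it has a non-tangential limit of modulus one at $\omega$; its model space is $K_\varphi=H^2\ominus\varphi H^2$, and $P_\varphi$ denotes the orthogonal projection onto $K_\varphi$. A sequence $\{x_n\}_{n\ge0}$ in a Hilbert space $\mathcal H$ is a Parseval frame if $\sum_{n\ge0}|\langle x,x_n\rangle|^2=\|x\|^2$ for all $x\in\mathcal H$. A complete sequence $\{e_n\}_{n\ge 0}$ of unit vectors in $\mathcal H$ is effective if for every $x\in\mathcal H$ the Kaczmarz iterates $x_0=\langle x,e_0\rangle e_0$, $x_n=x_{n-1}+\langle x-x_{n-1},e_n\rangle e_n$ converge to $x$ in norm. (Inner products are linear in the first argument.) Let $\mu$ be a Borel probability measure on $\mathbb{T}$ that is singular with respect to $m$, let $$\psi(z)=\int_{\mathbb{T}}\frac{\zeta+z}{\zeta-z}\,d\mu(\zeta)\quad(z\in\mathbb{D}),\qquad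 \varphi=\frac{\psi-1}{\psi+1},$$ and let $\{g_n\}_{n\ge0}\subset L^2(\mathbb{T},\mu)$ be the sequence attached to the monomials $e_n(\zeta)=\zeta^n$ by $$g_0=e_0,\qquad g_n=e_n-\sum_{k=0}^{n-1}\langle e_n,e_k\rangle_{L^2(\mu)}\,g_k .$$ Then: 1. $\varphi$ is inner and $\varphi(0)=0$. 2. The sequence $\{e_n\}_{n\ge0}$ is effective in $L^2(\mathbb{T},\mu)$, and $\{g_n\}_{n\ge0}$ is a Parseval frame for $L^2(\mathbb{T},\mu)$. 3. $\{P_\varphi(z^n)\}_{n\ge0}$ is a Parseval frame for $K_\varphi$. 4. For every $n\ge0$ and for $\mu$-almost every $\zeta\in\mathbb{T}$, the non-tangential limit of $P_\varphi(z^n)$ at $\zeta$ exists and $$g_n(\zeta)=\lim_{\angle w\to\zeta}P_\varphi(z^n)(w).$$ -/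

import Mathlib

open MeasureTheory Filter Topology
open scoped ENNReal Complex.UnitDisc

noncomputable section

/-! ### The unit circle and its measures -/

/-- The Borel σ-algebra of the unit circle `𝕋`. -/
instance Circle.instMeasurableSpaceBorel : MeasurableSpace Circle := borel Circle

instance Circle.instBorelSpaceBorel : BorelSpace Circle := ⟨rfl⟩

/-- Lebesgue measure `m` on the unit circle, normalized to have total mass one. -/
def circleLebesgue : Measure Circle :=
  (ENNReal.ofReal (2 * Real.pi))⁻¹ •
    (volume.restrict (Set.Ioc 0 (2 * Real.pi))).map Circle.exp

/-- The Herglotz transform `ψ(z) = ∫ (ζ + z) / (ζ - z) dμ(ζ)` of a measure on the circle. -/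
def herglotz (μ : Measure Circle) (z : 𝔻) : ℂ :=
  ∫ ζ : Circle, ((ζ : ℂ) + (z : ℂ)) / ((ζ : ℂ) - (z : ℂ)) ∂μ

/-- The function `φ = (ψ - 1) / (ψ + 1)`, where `ψ` is the Herglotz transform of `μ`. -/
def clarkFunction (μ : Measure Circle) (z : 𝔻) : ℂ :=
  (herglotz μ z - 1) / (herglotz μ z + 1)

/-- `f` has the non-tangential limit `c` at the point `ω` of the circle: `f(z) → c` as `z → ω`
inside each Stolz region `{z ∈ 𝔻 : |z - ω| < M (1 - |z|)}`. -/
def HasNontangentialLimit (f : 𝔻 → ℂ) (ω : Circle) (c : ℂ) : Prop :=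
  ∀ M : ℝ, Tendsto f
    (comap (fun z : 𝔻 => (z : ℂ)) (𝓝 (ω : ℂ)) ⊓
      𝓟 {z : 𝔻 | ‖(z : ℂ) - (ω : ℂ)‖ < M * (1 - ‖(z : ℂ)‖)}) (𝓝 c)

/-! ### The Hardy space of the disc -/

/-- The functions `f(z) = ∑ aₙ zⁿ` on the unit disc with square-summable Taylor coefficients. -/
def hardySubmodule : Submodule ℂ (𝔻 → ℂ) where
  carrier := {f | ∃ a : lp (fun _ : ℕ => ℂ) 2, ∀ z : 𝔻, HasSum (fun n => a n * (z : ℂ) ^ n) (f z)}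
  add_mem' := by
    rintro f g ⟨a, ha⟩ ⟨b, hb⟩
    refine ⟨a + b, fun z => ?_⟩
    simpa [add_mul] using (ha z).add (hb z)
  zero_mem' := ⟨0, fun z => by simp⟩
  smul_mem' := by
    rintro c f ⟨a, ha⟩
    refine ⟨c • a, fun z => ?_⟩
    simpa [mul_assoc] using (ha z).mul_left c

/-- The Hardy space `H²(𝔻)`, whose elements are functions on the disc. -/
def HardySpace : Type := hardySubmodule

namespace HardySpace

instance : AddCommGroup HardySpace := inferInstanceAs (AddCommGroup hardySubmodule)

instance : Module ℂ HardySpace := inferInstanceAs (Module ℂ hardySubmodule)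

instance : CoeFun HardySpace (fun _ => 𝔻 → ℂ) := ⟨fun f => f.1⟩

@[ext] theorem ext {f g : HardySpace} (h : ∀ z, f z = g z) : f = g := Subtype.ext (funext h)

@[simp] theorem add_apply (f g : HardySpace) (z : 𝔻) : (f + g) z = f z + g z := rfl

@[simp] theorem zero_apply (z : 𝔻) : (0 : HardySpace) z = 0 := rfl

@[simp] theorem smul_apply (c : ℂ) (f : HardySpace) (z : 𝔻) : (c • f) z = c * f z := rfl

theorem hasSum_ofLp (a : lp (fun _ : ℕ => ℂ) 2) (z : 𝔻) :
    HasSum (fun n => a n * (z : ℂ) ^ n) (∑' n, a n * (z : ℂ) ^ n) := by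
  refine Summable.hasSum (Summable.of_norm_bounded
    (g := fun n => ‖a‖ * ‖(z : ℂ)‖ ^ n) ?_ fun n => ?_)
  · exact (summable_geometric_of_lt_one (norm_nonneg _) z.norm_lt_one).mul_left _
  · rw [norm_mul, norm_pow]
    gcongr
    exact lp.norm_apply_le_norm two_ne_zero a n

theorem coeff_unique {a b : ℕ → ℂ} {f : 𝔻 → ℂ}
    (ha : ∀ z : 𝔻, HasSum (fun n => a n * (z : ℂ) ^ n) (f z))
    (hb : ∀ z : 𝔻, HasSum (fun n => b n * (z : ℂ) ^ n) (f z)) : a = b := by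
  classical
  let F : ℂ → ℂ := fun z => if hz : ‖z‖ < 1 then f (Complex.UnitDisc.mk z hz) else 0
  have key : ∀ c : ℕ → ℂ, (∀ z : 𝔻, HasSum (fun n => c n * (z : ℂ) ^ n) (f z)) →
      HasFPowerSeriesAt F (FormalMultilinearSeries.ofScalars ℂ c) 0 := by
    intro c hc
    rw [hasFPowerSeriesAt_iff]
    filter_upwards [Metric.ball_mem_nhds (0 : ℂ) one_pos] with z hz
    have hz' : ‖z‖ < 1 := by simpa using hz
    have := hc (Complex.UnitDisc.mk z hz')
    simpa [F, hz', FormalMultilinearSeries.coeff_ofScalars, mul_comm] using this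
  have h := (key a ha).eq_formalMultilinearSeries (key b hb)
  funext n
  simpa using congrArg (fun p => FormalMultilinearSeries.coeff p n) h

/-- The function `∑ aₙ zⁿ` with a given square-summable sequence of Taylor coefficients. -/
def ofLp (a : lp (fun _ : ℕ => ℂ) 2) : HardySpace :=
  ⟨fun z => ∑' n, a n * (z : ℂ) ^ n, a, hasSum_ofLp a⟩

theorem ofLp_apply (a : lp (fun _ : ℕ => ℂ) 2) (z : 𝔻) :
    ofLp a z = ∑' n, a n * (z : ℂ) ^ n := rfl

/-- `H²(𝔻)` is identified with `ℓ²` by sending a function to its Taylor coefficients. -/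
def coeff : HardySpace ≃ₗ[ℂ] lp (fun _ : ℕ => ℂ) 2 :=
  LinearEquiv.symm
    { toFun := ofLp
      map_add' := fun a b => ext fun z => by
        rw [add_apply, ofLp_apply, ofLp_apply, ofLp_apply,
          ← ((hasSum_ofLp a z).add (hasSum_ofLp b z)).tsum_eq]
        simp [add_mul]
      map_smul' := fun c a => ext fun z => by
        rw [smul_apply, ofLp_apply, ofLp_apply, RingHom.id_apply,
          ← ((hasSum_ofLp a z).mul_left c).tsum_eq]
        simp [mul_assoc]
      invFun := fun f => f.2.choose
      left_inv := fun a =>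
        Subtype.ext (coeff_unique (ofLp a).2.choose_spec (hasSum_ofLp a))
      right_inv := fun f => ext fun z =>
        (hasSum_ofLp f.2.choose z).unique (f.2.choose_spec z) }

theorem hasSum_coeff (f : HardySpace) (z : 𝔻) :
    HasSum (fun n => coeff f n * (z : ℂ) ^ n) (f z) := f.2.choose_spec z

/-- The norm of `H²(𝔻)` is `‖f‖² = ∑ |aₙ|²`. -/
instance : NormedAddCommGroup HardySpace :=
  NormedAddCommGroup.induced HardySpace (lp (fun _ : ℕ => ℂ) 2) coeff coeff.injective

/-- The inner product of `H²(𝔻)` is that of the sequences of Taylor coefficients. -/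
instance : InnerProductSpace ℂ HardySpace :=
  InnerProductSpace.induced (𝕜 := ℂ) (coeff : HardySpace ≃ₗ[ℂ] lp (fun _ : ℕ => ℂ) 2)

/-- The identification of `H²(𝔻)` with `ℓ²` is isometric. -/
def coeffIsometry : HardySpace ≃ₗᵢ[ℂ] lp (fun _ : ℕ => ℂ) 2 := ⟨coeff, fun _ => rfl⟩

instance : CompleteSpace HardySpace :=
  coeffIsometry.toIsometryEquiv.completeSpace

/-- The monomial `zⁿ`. -/
def monomial (n : ℕ) : HardySpace :=
  ⟨fun z => (z : ℂ) ^ n, lp.single 2 n 1, fun z => by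
    convert hasSum_ite_eq n ((z : ℂ) ^ n) using 2 with k
    by_cases h : k = n
    · subst h; simp
    · simp [h, lp.single_apply]⟩

@[simp] theorem monomial_apply (n : ℕ) (z : 𝔻) : monomial n z = (z : ℂ) ^ n := rfl

end HardySpace

/-! ### Inner functions and model spaces -/

/-- `φ` is inner: it belongs to `H²`, and its non-tangential boundary values have modulus one
almost everywhere with respect to Lebesgue measure. -/
def IsInner (φ : 𝔻 → ℂ) : Prop :=
  φ ∈ hardySubmodule ∧
    ∀ᵐ ω ∂circleLebesgue, ∃ c : ℂ, ‖c‖ = 1 ∧ HasNontangentialLimit φ ω c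

/-- The subspace `φ H²` of `H²` (for `φ` inner, all the products `φ f` belong to `H²`). -/
def mulHardy (φ : 𝔻 → ℂ) : Submodule ℂ HardySpace where
  carrier := {h | ∃ f : HardySpace, ∀ z, h z = φ z * f z}
  add_mem' := by
    rintro g h ⟨f, hf⟩ ⟨k, hk⟩
    exact ⟨f + k, fun z => by simp [hf, hk, mul_add]⟩
  zero_mem' := ⟨0, fun z => by simp⟩
  smul_mem' := by
    rintro c h ⟨f, hf⟩
    exact ⟨c • f, fun z => by simp [hf, mul_left_comm]⟩

/-- The model space `K_φ = H² ⊖ φ H²`. -/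
abbrev modelSpace (φ : 𝔻 → ℂ) : Submodule ℂ HardySpace := (mulHardy φ)ᗮ

/-- The orthogonal projection `P_φ(zⁿ)` of the monomial `zⁿ` onto `K_φ`. -/
def modelFrame (φ : 𝔻 → ℂ) (n : ℕ) : modelSpace φ :=
  (modelSpace φ).orthogonalProjectionOnto (HardySpace.monomial n)

/-! ### Kaczmarz algorithm and Parseval frames

Mathlib's inner product is conjugate-linear in its first argument, so that the inner product
`⟨x, y⟩`, linear in `x`, is written `inner ℂ y x`. -/

section Kaczmarz

variable {H : Type*} [NormedAddCommGroup H] [InnerProductSpace ℂ H]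

/-- The Kaczmarz iterates `x₀ = ⟨x, e₀⟩ e₀`, `xₙ = xₙ₋₁ + ⟨x - xₙ₋₁, eₙ⟩ eₙ`. -/
def kaczmarzIter (e : ℕ → H) (x : H) : ℕ → H
  | 0 => inner ℂ (e 0) x • e 0
  | n + 1 => kaczmarzIter e x n + inner ℂ (e (n + 1)) (x - kaczmarzIter e x n) • e (n + 1)

/-- A complete sequence of unit vectors is effective if the Kaczmarz iterates of every vector
converge to that vector. -/
structure IsEffective (e : ℕ → H) : Prop where
  norm_eq_one : ∀ n, ‖e n‖ = 1
  complete : (Submodule.span ℂ (Set.range e)).topologicalClosure = ⊤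
  tendsto : ∀ x, Tendsto (kaczmarzIter e x) atTop (𝓝 x)

/-- The sequence `γ₀ = e₀`, `γₙ = eₙ - ∑_{k < n} ⟨eₙ, e_k⟩ γ_k` attached to `e`. -/
def kaczmarzFrame (e : ℕ → H) (n : ℕ) : H :=
  e n - ∑ k : Fin n, inner ℂ (e k) (e n) • kaczmarzFrame e k
termination_by n
decreasing_by exact k.2

/-- `g` is a Parseval frame: `∑ |⟨x, gₙ⟩|² = ‖x‖²` for every `x`. -/
def IsParsevalFrame (g : ℕ → H) : Prop :=
  ∀ x, HasSum (fun n => ‖inner ℂ (g n) x‖ ^ 2) (‖x‖ ^ 2)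

end Kaczmarz

/-- The monomial `ζⁿ` as an element of `L²(𝕋, μ)`. -/
def circleMonomial (μ : Measure Circle) [IsFiniteMeasure μ] (n : ℕ) : Lp ℂ 2 μ :=
  ContinuousMap.toLp 2 μ ℂ ⟨fun ζ : Circle => (ζ : ℂ) ^ n, by fun_prop⟩

end

/-!
Write `H = L²(μ)`, let `U` be multiplication by `ζ` on `H`, and let `v = 1`, so that `eₙ = Uⁿ v`.
The proof rests on the operator `T x = U⁻¹ (x - ⟨x, v⟩ v)` (`kaczmarzStep`). The residuals of the
Kaczmarz algorithm are `x - xₙ = Uⁿ⁺¹ Tⁿ⁺¹ x`, the frame coefficients are `⟨x, gₙ⟩ = ⟨Tⁿ x, v⟩`, and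
`‖Tⁿ x‖² = ‖x‖² - ∑_{k < n} |⟨x, g_k⟩|²`. Hence `V x = ∑ ⟨x, gₙ⟩ zⁿ` (`clarkTransform`) is a
contraction of `H` into the Hardy space, and the algorithm recovers `x` exactly when `‖V x‖ = ‖x‖`:
effectiveness and the Parseval property both say that `V` is isometric. The transform turns `T` into
the backward shift.

The vectors that the algorithm recovers form a closed subspace which contains `v`; if it contains
`U⁻¹ v`, it is invariant under `U` and `U⁻¹`, so by the Stone–Weierstrass theorem it is all of
`L²(μ)`. A power series identity for the Cauchy transform of `μ` gives `φ(z) = z V(U⁻¹ v)(z)`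
(`clarkFunction_eq_clarkSymbol`). This puts `φ` in the Hardy space, gives `φ(0) = 0`, and reduces
the isometry of `V` to `‖φ‖ = 1`.

That `φ` is inner, hence of norm one, is where singularity enters. Since `1 - |φ|² = |1 - φ|² Re ψ`
and `Re ψ` is the Poisson integral of `μ`, it is enough to know that `φ` has nontangential limits
(Fatou's theorem, `exists_boundary_function`) and that `Re ψ` tends to zero nontangentially almost
everywhere for Lebesgue measure (`ae_tendsto_poissonIntegral_zero`). The dual fact that `Re ψ` tends
to infinity at `μ`-almost every point shows that `φ` has the nontangential limit one there. All of
this follows from the Besicovitch differentiation theorem, together with comparisons of the Poisson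
kernel in a Stolz region with averages over balls.

Once `V` is isometric, the functions `zⁿ φ` are orthonormal and orthogonal to its range, and every
`zⁿ` is an element of the range plus a multiple of `φ`; so `P_φ(zⁿ) = V gₙ`
(`modelFrame_eq_clarkTransform`). The relation `V(U x) = z V x + ⟨U x, v⟩ (1 - φ)` yields by
induction that `V eₙ` has the nontangential limit `ζⁿ` wherever `φ` has the limit one, and `gₙ` is a
combination of the `e_k`.
-/

noncomputable section

/-! ### The Kaczmarz algorithm for a stationary sequence -/

section Stationary

variable {H : Type*} [NormedAddCommGroup H] [InnerProductSpace ℂ H]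

/-- The operator `x ↦ U⁻¹ (x - ⟨x, v⟩ v)`, which drives the Kaczmarz algorithm of the sequence
`eₙ = Uⁿ v`. -/
def kaczmarzStep (U : H ≃ₗᵢ[ℂ] H) (v : H) : H →ₗ[ℂ] H where
  toFun x := U.symm (x - inner ℂ v x • v)
  map_add' x y := by rw [← map_add, inner_add_right, add_smul]; congr 1; abel
  map_smul' c x := by
    rw [RingHom.id_apply, ← map_smul, inner_smul_right, smul_sub, smul_smul]

/-- The powers of `kaczmarzStep U v`. Up to a power of `U`, which does not change norms, they give
the residuals of the Kaczmarz algorithm: the one of index `n + 1` is `U⁻ⁿ⁻¹ (x - xₙ)`. -/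
def kaczmarzResidual (U : H ≃ₗᵢ[ℂ] H) (v : H) (n : ℕ) : H →ₗ[ℂ] H := (kaczmarzStep U v) ^ n

variable {U : H ≃ₗᵢ[ℂ] H} {v : H} {e : ℕ → H}

theorem kaczmarzStep_apply (x : H) :
    kaczmarzStep U v x = U.symm (x - inner ℂ v x • v) := rfl

@[simp] theorem kaczmarzResidual_zero (x : H) : kaczmarzResidual U v 0 x = x := rfl

theorem kaczmarzResidual_succ (n : ℕ) (x : H) :
    kaczmarzResidual U v (n + 1) x = kaczmarzStep U v (kaczmarzResidual U v n x) := by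
  simp [kaczmarzResidual, pow_succ']

theorem kaczmarzResidual_succ' (n : ℕ) (x : H) :
    kaczmarzResidual U v (n + 1) x = kaczmarzResidual U v n (kaczmarzStep U v x) := by
  simp [kaczmarzResidual, pow_succ]

theorem kaczmarzStep_self (hv : ‖v‖ = 1) : kaczmarzStep U v v = 0 := by
  simp [kaczmarzStep_apply, inner_self_eq_norm_sq_to_K, hv]

theorem kaczmarzStep_map (x : H) :
    kaczmarzStep U v (U x) = x - inner ℂ v (U x) • U.symm v := by
  simp [kaczmarzStep_apply]

theorem norm_kaczmarzStep_sq (hv : ‖v‖ = 1) (x : H) :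
    ‖kaczmarzStep U v x‖ ^ 2 = ‖x‖ ^ 2 - ‖inner ℂ v x‖ ^ 2 := by
  rw [kaczmarzStep_apply, LinearIsometryEquiv.norm_map]
  have h : inner ℂ (inner ℂ v x • v) (x - inner ℂ v x • v) = 0 := by
    rw [inner_sub_right, inner_smul_left, inner_smul_left, inner_smul_right,
      inner_self_eq_norm_sq_to_K, hv]
    simp
  have := norm_add_sq_eq_norm_sq_add_norm_sq_of_inner_eq_zero _ _ h
  rw [add_sub_cancel, norm_smul, hv] at this
  linarith

theorem norm_kaczmarzResidual_sq (hv : ‖v‖ = 1) (x : H) (n : ℕ) :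
    ‖kaczmarzResidual U v n x‖ ^ 2 =
      ‖x‖ ^ 2 - ∑ k ∈ Finset.range n, ‖inner ℂ v (kaczmarzResidual U v k x)‖ ^ 2 := by
  induction n with
  | zero => simp
  | succ n ih =>
    rw [kaczmarzResidual_succ, norm_kaczmarzStep_sq hv, ih, Finset.sum_range_succ]
    ring

theorem inner_stationary_map (he0 : e 0 = v) (he : ∀ n, e (n + 1) = U (e n))
    (n : ℕ) (x : H) :
    inner ℂ (e n) ((U : H → H)^[n] x) = inner ℂ v x := by
  induction n generalizing x with
  | zero => simp [he0]
  | succ n ih =>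
    rw [Function.iterate_succ_apply', he, LinearIsometryEquiv.inner_map_map, ih]

theorem norm_stationary (he0 : e 0 = v) (he : ∀ n, e (n + 1) = U (e n))
    (hv : ‖v‖ = 1) (n : ℕ) : ‖e n‖ = 1 := by
  induction n with
  | zero => rw [he0, hv]
  | succ n ih => rw [he, LinearIsometryEquiv.norm_map, ih]

theorem iterate_kaczmarzStep (he0 : e 0 = v) (he : ∀ n, e (n + 1) = U (e n))
    (n : ℕ) (x : H) :
    (U : H → H)^[n + 1] (kaczmarzStep U v x) =
      (U : H → H)^[n] x - inner ℂ v x • e n := by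
  rw [Function.iterate_succ_apply, kaczmarzStep_apply, LinearIsometryEquiv.apply_symm_apply]
  induction n with
  | zero => simp [he0]
  | succ n ih => simp only [Function.iterate_succ_apply', ih, he, map_sub, map_smul]

theorem iterate_kaczmarzResidual (he0 : e 0 = v) (he : ∀ n, e (n + 1) = U (e n))
    (n : ℕ) (x : H) :
    (U : H → H)^[n] (kaczmarzResidual U v n x) =
      x - ∑ k ∈ Finset.range n, inner ℂ v (kaczmarzResidual U v k x) • e k := by
  induction n with
  | zero => simp
  | succ n ih =>
    rw [kaczmarzResidual_succ, iterate_kaczmarzStep he0 he, ih, Finset.sum_range_succ]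
    abel

theorem kaczmarzIter_stationary (he0 : e 0 = v) (he : ∀ n, e (n + 1) = U (e n))
    (n : ℕ) (x : H) :
    x - kaczmarzIter e x n = (U : H → H)^[n + 1] (kaczmarzResidual U v (n + 1) x) := by
  induction n with
  | zero => rw [iterate_kaczmarzResidual he0 he]; simp [kaczmarzIter, he0]
  | succ n ih =>
    rw [kaczmarzIter, ← sub_sub, ih, inner_stationary_map he0 he, kaczmarzResidual_succ (n + 1),
      iterate_kaczmarzStep he0 he]

/-- The recursion that defines `gₙ` expresses `⟨x, gₙ⟩` as the inner product of `eₙ` with the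
residual `x - xₙ₋₁`. -/
theorem inner_kaczmarzFrame_stationary (he0 : e 0 = v) (he : ∀ n, e (n + 1) = U (e n))
    (n : ℕ) (x : H) :
    inner ℂ (kaczmarzFrame e n) x = inner ℂ v (kaczmarzResidual U v n x) := by
  induction n using Nat.strong_induction_on with
  | _ n ih =>
    rw [kaczmarzFrame, inner_sub_left, sum_inner, ← inner_stationary_map he0 he n,
      iterate_kaczmarzResidual he0 he, inner_sub_right, inner_sum, Finset.sum_range]
    congr 1
    refine Finset.sum_congr rfl fun k _ => ?_
    rw [inner_smul_left, inner_smul_right, ih k k.2, inner_conj_symm, mul_comm]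

theorem norm_sub_kaczmarzIter (he0 : e 0 = v) (he : ∀ n, e (n + 1) = U (e n))
    (n : ℕ) (x : H) :
    ‖x - kaczmarzIter e x n‖ = ‖kaczmarzResidual U v (n + 1) x‖ := by
  rw [kaczmarzIter_stationary he0 he]
  generalize kaczmarzResidual U v (n + 1) x = y
  generalize n + 1 = m
  induction m with
  | zero => rfl
  | succ m ih => rw [Function.iterate_succ_apply', LinearIsometryEquiv.norm_map, ih]

theorem kaczmarzFrame_mem_span (e : ℕ → H) (n : ℕ) :
    kaczmarzFrame e n ∈ Submodule.span ℂ (Set.range e) := by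
  induction n using Nat.strong_induction_on with
  | _ n ih =>
    rw [kaczmarzFrame]
    exact sub_mem (Submodule.subset_span (Set.mem_range_self n))
      (sum_mem fun k _ => Submodule.smul_mem _ _ (ih k k.2))

/-- The vectors recovered by the Kaczmarz algorithm of the sequence `Uⁿ v`. -/
def kaczmarzSubmodule (U : H ≃ₗᵢ[ℂ] H) (v : H) : Submodule ℂ H where
  carrier := {x | Tendsto (fun n => kaczmarzResidual U v n x) atTop (𝓝 0)}
  add_mem' hx hy := by simpa using Tendsto.add hx hy
  zero_mem' := by simp
  smul_mem' c x hx := by simpa using Tendsto.const_smul hx c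

end Stationary

/-! ### Coefficients, point evaluations and the shift on the Hardy space -/

namespace HardySpace

theorem coeff_eq_of_hasSum {f : HardySpace} {a : ℕ → ℂ}
    (h : ∀ z : 𝔻, HasSum (fun n => a n * (z : ℂ) ^ n) (f z)) (n : ℕ) : coeff f n = a n :=
  congrFun (coeff_unique (hasSum_coeff f) h) n

theorem norm_coeff (f : HardySpace) : ‖coeff f‖ = ‖f‖ := rfl

theorem hasSum_inner_coeff (f g : HardySpace) :
    HasSum (fun n => inner ℂ (coeff f n) (coeff g n)) (inner ℂ f g) :=
  lp.hasSum_inner (coeff f) (coeff g)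

theorem hasSum_norm_coeff_sq (f : HardySpace) :
    HasSum (fun n => ‖coeff f n‖ ^ 2) (‖f‖ ^ 2) := by
  have h := hasSum_inner_coeff f f
  simp only [inner_self_eq_norm_sq_to_K] at h
  exact_mod_cast h

theorem coeff_monomial (n k : ℕ) : coeff (monomial n) k = if k = n then 1 else 0 := by
  refine coeff_eq_of_hasSum (a := fun k => if k = n then 1 else 0) (fun z => ?_) k
  rw [monomial_apply]
  convert hasSum_ite_eq n ((z : ℂ) ^ n) using 2 with k
  by_cases h : k = n <;> simp [h]

theorem inner_monomial (n : ℕ) (f : HardySpace) : inner ℂ (monomial n) f = coeff f n := by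
  refine (hasSum_inner_coeff _ _).unique ?_
  convert hasSum_ite_eq n (coeff f n) using 2 with k
  by_cases h : k = n <;> simp [coeff_monomial, h]

/-- Evaluation at a point of the disc. -/
def evalAt (z : 𝔻) : HardySpace →L[ℂ] ℂ :=
  LinearMap.mkContinuous
    { toFun := fun f => f z
      map_add' := fun f g => add_apply f g z
      map_smul' := fun c f => smul_apply c f z } (1 - ‖(z : ℂ)‖)⁻¹ fun f => by
    have h := (hasSum_geometric_of_lt_one (norm_nonneg _) z.norm_lt_one).mul_right ‖f‖
    have h' := hasSum_coeff f z
    refine h'.norm_le_of_bounded h fun n => ?_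
    rw [norm_mul, norm_pow, mul_comm]
    gcongr
    exact lp.norm_apply_le_norm two_ne_zero (coeff f) n

@[simp] theorem evalAt_apply (z : 𝔻) (f : HardySpace) : evalAt z f = f z := rfl

/-- The Taylor coefficients of `z f(z)`. -/
def shiftCoeff (f : HardySpace) : ℕ → ℂ
  | 0 => 0
  | n + 1 => coeff f n

theorem hasSum_shiftCoeff (f : HardySpace) (z : 𝔻) :
    HasSum (fun n => shiftCoeff f n * (z : ℂ) ^ n) (z * f z) := by
  rw [← hasSum_nat_add_iff' 1]
  simpa [shiftCoeff, pow_succ', mul_left_comm] using (hasSum_coeff f z).mul_left (z : ℂ)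

/-- Multiplication by the coordinate function. -/
def shift (f : HardySpace) : HardySpace :=
  ⟨fun z => z * f z,
    ⟨shiftCoeff f, by
      have h : Memℓp (fun k => coeff f k) 2 := lp.memℓp _
      refine memℓp_gen ?_
      rw [← summable_nat_add_iff 1]
      exact h.summable (by norm_num)⟩,
    hasSum_shiftCoeff f⟩

@[simp] theorem shift_apply (f : HardySpace) (z : 𝔻) : shift f z = z * f z := rfl

theorem coeff_shift (f : HardySpace) (n : ℕ) : coeff (shift f) n = shiftCoeff f n :=
  coeff_eq_of_hasSum (f := shift f) (hasSum_shiftCoeff f) n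

@[simp] theorem coeff_shift_zero (f : HardySpace) : coeff (shift f) 0 = 0 := coeff_shift f 0

@[simp] theorem coeff_shift_succ (f : HardySpace) (n : ℕ) :
    coeff (shift f) (n + 1) = coeff f n := coeff_shift f (n + 1)

theorem inner_shift_shift (f g : HardySpace) : inner ℂ (shift f) (shift g) = inner ℂ f g := by
  refine (hasSum_inner_coeff _ _).unique ?_
  rw [← hasSum_nat_add_iff' 1]
  simpa using hasSum_inner_coeff f g

theorem norm_shift (f : HardySpace) : ‖shift f‖ = ‖f‖ := by
  rw [@norm_eq_sqrt_re_inner ℂ, inner_shift_shift, ← @norm_eq_sqrt_re_inner ℂ]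

theorem iterate_shift_apply (f : HardySpace) (n : ℕ) (z : 𝔻) :
    (shift^[n] f) z = (z : ℂ) ^ n * f z := by
  induction n with
  | zero => simp
  | succ n ih => rw [Function.iterate_succ_apply', shift_apply, ih]; ring

end HardySpace

theorem isParsevalFrame_modelFrame (φ : 𝔻 → ℂ) : IsParsevalFrame (modelFrame φ) := by
  intro x
  have h (n : ℕ) : inner ℂ (modelFrame φ n) x = HardySpace.coeff (x : HardySpace) n := by
    rw [modelFrame, Submodule.inner_orthogonalProjectionOnto_eq_of_mem_right,
      HardySpace.inner_monomial]
  simp only [h]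
  exact HardySpace.hasSum_norm_coeff_sq (x : HardySpace)

/-! ### The Clark transform -/

section Clark

open HardySpace

variable {H : Type*} [NormedAddCommGroup H] [InnerProductSpace ℂ H]
variable {U : H ≃ₗᵢ[ℂ] H} {v : H}

theorem summable_norm_inner_kaczmarzResidual (hv : ‖v‖ = 1) (x : H) :
    Summable fun n => ‖inner ℂ v (kaczmarzResidual U v n x)‖ ^ 2 := by
  refine summable_of_sum_range_le (c := ‖x‖ ^ 2) (fun n => by positivity) fun n => ?_
  have := norm_kaczmarzResidual_sq (U := U) hv x n
  have : 0 ≤ ‖kaczmarzResidual U v n x‖ ^ 2 := by positivity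
  linarith

/-- The coefficients that the Kaczmarz algorithm computes for `x`, as a sequence in `ℓ²`. -/
def kaczmarzCoeff (U : H ≃ₗᵢ[ℂ] H) (hv : ‖v‖ = 1) (x : H) : lp (fun _ : ℕ => ℂ) 2 :=
  ⟨fun n => inner ℂ v (kaczmarzResidual U v n x), memℓp_gen (by
    simpa using summable_norm_inner_kaczmarzResidual hv x)⟩

/-- The Clark transform `x ↦ ∑ ⟨x, gₙ⟩ zⁿ` into the Hardy space, where `g` is the frame attached to
the sequence `Uⁿ v`. -/
def clarkTransform (U : H ≃ₗᵢ[ℂ] H) (hv : ‖v‖ = 1) : H →ₗ[ℂ] HardySpace :=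
  coeff.symm.toLinearMap ∘ₗ
    { toFun := kaczmarzCoeff U hv
      map_add' := fun x y => Subtype.ext <| funext fun n => by
        change inner ℂ v (kaczmarzResidual U v n (x + y)) =
          inner ℂ v (kaczmarzResidual U v n x) + inner ℂ v (kaczmarzResidual U v n y)
        rw [map_add, inner_add_right]
      map_smul' := fun c x => Subtype.ext <| funext fun n => by
        change inner ℂ v (kaczmarzResidual U v n (c • x)) =
          c * inner ℂ v (kaczmarzResidual U v n x)
        rw [map_smul, inner_smul_right] }

variable (hv : ‖v‖ = 1)

theorem coeff_clarkTransform (x : H) (n : ℕ) :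
    coeff (clarkTransform U hv x) n = inner ℂ v (kaczmarzResidual U v n x) := by
  simp [clarkTransform, kaczmarzCoeff]

/-- The limit of the residuals measures how far the Clark transform is from preserving the norm. -/
theorem tendsto_norm_kaczmarzResidual_sq (x : H) :
    Tendsto (fun n => ‖kaczmarzResidual U v n x‖ ^ 2) atTop
      (𝓝 (‖x‖ ^ 2 - ‖clarkTransform U hv x‖ ^ 2)) := by
  simp only [norm_kaczmarzResidual_sq hv]
  refine tendsto_const_nhds.sub ?_
  simpa only [coeff_clarkTransform] using
    (hasSum_norm_coeff_sq (clarkTransform U hv x)).tendsto_sum_nat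

theorem norm_clarkTransform_le (x : H) : ‖clarkTransform U hv x‖ ≤ ‖x‖ := by
  rw [← sq_le_sq₀ (norm_nonneg _) (norm_nonneg _), ← sub_nonneg]
  exact ge_of_tendsto' (tendsto_norm_kaczmarzResidual_sq hv x) fun n => by positivity

theorem mem_kaczmarzSubmodule_iff {x : H} :
    x ∈ kaczmarzSubmodule U v ↔ ‖clarkTransform U hv x‖ = ‖x‖ := by
  have h := tendsto_norm_kaczmarzResidual_sq (U := U) hv x
  change Tendsto _ _ _ ↔ _
  constructor
  · intro hx
    have := tendsto_nhds_unique h (by simpa using hx.norm.pow 2)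
    rw [← sq_eq_sq₀ (norm_nonneg _) (norm_nonneg _)]
    linarith
  · intro hx
    rw [hx, sub_self] at h
    have := h.sqrt
    simpa [Real.sqrt_sq, tendsto_zero_iff_norm_tendsto_zero] using this

theorem isClosed_kaczmarzSubmodule (hv : ‖v‖ = 1) : IsClosed (kaczmarzSubmodule U v : Set H) := by
  have : (kaczmarzSubmodule U v : Set H) = {x | ‖clarkTransform U hv x‖ = ‖x‖} :=
    Set.ext fun x => mem_kaczmarzSubmodule_iff hv
  rw [this]
  have hc : Continuous (clarkTransform U hv) :=
    ((clarkTransform U hv).mkContinuous 1 fun x => by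
      simpa using norm_clarkTransform_le hv x).continuous
  exact isClosed_eq hc.norm continuous_norm

theorem self_mem_kaczmarzSubmodule (hv : ‖v‖ = 1) : v ∈ kaczmarzSubmodule U v := by
  refine tendsto_const_nhds.congr' ?_
  filter_upwards [eventually_ge_atTop 1] with n hn
  obtain ⟨n, rfl⟩ := Nat.exists_eq_add_of_le' hn
  rw [kaczmarzResidual_succ', kaczmarzStep_self hv, map_zero]

theorem kaczmarzStep_mem_kaczmarzSubmodule_iff {x : H} :
    kaczmarzStep U v x ∈ kaczmarzSubmodule U v ↔ x ∈ kaczmarzSubmodule U v := by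
  change Tendsto _ _ _ ↔ Tendsto _ _ _
  simp only [← kaczmarzResidual_succ']
  exact tendsto_add_atTop_iff_nat (f := fun n => kaczmarzResidual U v n x) 1

theorem map_mem_kaczmarzSubmodule (h : U.symm v ∈ kaczmarzSubmodule U v) {x : H}
    (hx : x ∈ kaczmarzSubmodule U v) : U x ∈ kaczmarzSubmodule U v := by
  rw [← kaczmarzStep_mem_kaczmarzSubmodule_iff, kaczmarzStep_map]
  exact sub_mem hx (Submodule.smul_mem _ _ h)

theorem symm_map_mem_kaczmarzSubmodule (h : U.symm v ∈ kaczmarzSubmodule U v) {x : H}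
    (hx : x ∈ kaczmarzSubmodule U v) : U.symm x ∈ kaczmarzSubmodule U v := by
  have : U.symm x = kaczmarzStep U v x + inner ℂ v x • U.symm v := by
    simp [kaczmarzStep_apply]
  rw [this]
  exact add_mem (kaczmarzStep_mem_kaczmarzSubmodule_iff.2 hx) (Submodule.smul_mem _ _ h)

/-- In terms of Taylor coefficients: the Clark transform turns `kaczmarzStep U v` into the backward
shift. -/
theorem clarkTransform_eq (x : H) (z : 𝔻) :
    clarkTransform U hv x z = inner ℂ v x + z * clarkTransform U hv (kaczmarzStep U v x) z := by
  refine (hasSum_coeff _ z).unique ?_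
  rw [← hasSum_nat_add_iff' 1]
  simpa [coeff_clarkTransform, kaczmarzResidual_succ', pow_succ', mul_left_comm] using
    (hasSum_coeff (clarkTransform U hv (kaczmarzStep U v x)) z).mul_left (z : ℂ)

theorem clarkTransform_self (z : 𝔻) : clarkTransform U hv v z = 1 := by
  rw [clarkTransform_eq, kaczmarzStep_self hv, map_zero]
  simp [inner_self_eq_norm_sq_to_K, hv]

theorem inner_clarkTransform_shift (x : H) (f : HardySpace) :
    inner ℂ (clarkTransform U hv x) (shift f) =
      inner ℂ (clarkTransform U hv (kaczmarzStep U v x)) f := by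
  refine (hasSum_inner_coeff _ _).unique ?_
  rw [← hasSum_nat_add_iff' 1]
  simpa [coeff_clarkTransform, kaczmarzResidual_succ'] using
    hasSum_inner_coeff (clarkTransform U hv (kaczmarzStep U v x)) f

variable {φ : 𝔻 → ℂ}

theorem clarkTransform_map (hφ : ∀ z : 𝔻, φ z = z * clarkTransform U hv (U.symm v) z)
    (x : H) (z : 𝔻) :
    clarkTransform U hv (U x) z =
      z * clarkTransform U hv x z + inner ℂ v (U x) * (1 - φ z) := by
  rw [clarkTransform_eq, kaczmarzStep_map, map_sub, map_smul, hφ, sub_eq_add_neg, ← neg_smul]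
  simp only [add_apply, smul_apply]
  ring

theorem norm_clarkTransform (hM : kaczmarzSubmodule U v = ⊤) (x : H) :
    ‖clarkTransform U hv x‖ = ‖x‖ :=
  (mem_kaczmarzSubmodule_iff hv).1 (hM ▸ Submodule.mem_top)

theorem inner_clarkTransform (hM : kaczmarzSubmodule U v = ⊤) (x y : H) :
    inner ℂ (clarkTransform U hv x) (clarkTransform U hv y) = inner ℂ x y :=
  LinearIsometry.inner_map_map ⟨clarkTransform U hv, norm_clarkTransform hv hM⟩ x y

theorem inner_clarkTransform_iterate_shift (hM : kaczmarzSubmodule U v = ⊤) (x : H) (n : ℕ) :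
    inner ℂ (clarkTransform U hv x) (shift^[n] (shift (clarkTransform U hv (U.symm v)))) = 0 := by
  induction n generalizing x with
  | zero =>
    rw [Function.iterate_zero_apply, inner_clarkTransform_shift, inner_clarkTransform hv hM,
      kaczmarzStep_apply, LinearIsometryEquiv.inner_map_map, inner_sub_left, inner_smul_left,
      inner_self_eq_norm_sq_to_K, hv]
    simp
  | succ n ih => rw [Function.iterate_succ_apply', inner_clarkTransform_shift, ih]

/-- The functions `zⁿ φ`, for `φ = z V(U⁻¹ v)`, are orthonormal. -/
theorem orthonormal_iterate_shift (hM : kaczmarzSubmodule U v = ⊤) :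
    Orthonormal ℂ fun n : ℕ => shift^[n] (shift (clarkTransform U hv (U.symm v))) := by
  have hn (n : ℕ) (f : HardySpace) : ‖shift^[n] f‖ = ‖f‖ := by
    induction n with
    | zero => rfl
    | succ n ih => rw [Function.iterate_succ_apply', norm_shift, ih]
  have h0 (n k : ℕ) : inner ℂ (shift^[n] (shift (clarkTransform U hv (U.symm v))))
      (shift^[n + (k + 1)] (shift (clarkTransform U hv (U.symm v)))) = 0 := by
    induction n with
    | zero =>
      rw [Function.iterate_zero_apply, zero_add, Function.iterate_succ_apply', inner_shift_shift,
        inner_clarkTransform_iterate_shift hv hM]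
    | succ n ih =>
      rw [add_right_comm, Function.iterate_succ_apply', Function.iterate_succ_apply',
        inner_shift_shift, ih]
  refine ⟨fun n => ?_, fun m n hmn => ?_⟩
  · rw [hn, norm_shift, norm_clarkTransform hv hM, LinearIsometryEquiv.norm_map, hv]
  · rcases lt_or_gt_of_ne hmn with h | h
    · obtain ⟨k, rfl⟩ := Nat.exists_eq_add_of_lt h
      exact h0 m k
    · obtain ⟨k, rfl⟩ := Nat.exists_eq_add_of_lt h
      exact inner_eq_zero_symm.1 (h0 n k)

/-- The Clark transform takes its values in the model space: an element `φ f` of `φ H²` is the sum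
of the orthogonal series `∑ aₙ zⁿ φ`, where the `aₙ` are the Taylor coefficients of `f`. -/
theorem clarkTransform_mem_modelSpace (hM : kaczmarzSubmodule U v = ⊤)
    (hφ : ∀ z : 𝔻, φ z = z * clarkTransform U hv (U.symm v) z) (x : H) :
    clarkTransform U hv x ∈ modelSpace φ := by
  rw [Submodule.mem_orthogonal']
  rintro h ⟨f, hf⟩
  have hsum := (orthonormal_iterate_shift hv hM).orthogonalFamily.hasSum_linearIsometry (coeff f)
  set h' := (orthonormal_iterate_shift hv hM).orthogonalFamily.linearIsometry (coeff f)
  simp only [LinearIsometry.toSpanSingleton_apply] at hsum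
  have hh : h' = h := by
    ext z
    have h1 := (evalAt z).hasSum hsum
    refine h1.unique ?_
    rw [hf z]
    convert! (hasSum_coeff f z).mul_left (φ z) using 2 with n
    rw [map_smul, evalAt_apply, iterate_shift_apply, shift_apply, ← hφ,
      smul_eq_mul]
    ring
  rw [← hh]
  have h2 := (innerSL ℂ (clarkTransform U hv x)).hasSum hsum
  refine h2.unique ?_
  convert hasSum_zero with n
  simp [inner_clarkTransform_iterate_shift hv hM]

/-- The monomials lie in the sum of the range of the Clark transform and `φ H²`. -/
theorem exists_monomial_eq_clarkTransform_add
    (hφ : ∀ z : 𝔻, φ z = z * clarkTransform U hv (U.symm v) z) (n : ℕ) :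
    ∃ (y : H) (p : HardySpace), ∀ z : 𝔻, (z : ℂ) ^ n = clarkTransform U hv y z + φ z * p z := by
  induction n with
  | zero => exact ⟨v, 0, fun z => by simp [clarkTransform_self]⟩
  | succ n ih =>
    obtain ⟨y, p, h⟩ := ih
    refine ⟨U y - inner ℂ v (U y) • v, shift p + inner ℂ v (U y) • monomial 0, fun z => ?_⟩
    have h1 : clarkTransform U hv (U y - inner ℂ v (U y) • v) z =
        clarkTransform U hv (U y) z - inner ℂ v (U y) := by
      rw [map_sub, map_smul, sub_eq_add_neg, ← neg_smul, add_apply, smul_apply,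
        clarkTransform_self]
      ring
    rw [h1, clarkTransform_map hv hφ, pow_succ', h]
    simp only [add_apply, smul_apply, shift_apply, monomial_apply]
    ring

/-- The Clark transform carries the frame of the Kaczmarz algorithm to that of the model space. The
decomposition `zⁿ = V y + φ p` is orthogonal, so that `P_φ(zⁿ) = V y`; testing against the range of
`V` identifies `y` with `gₙ`. -/
theorem modelFrame_eq_clarkTransform {e : ℕ → H} (he0 : e 0 = v) (he : ∀ n, e (n + 1) = U (e n))
    (hM : kaczmarzSubmodule U v = ⊤)
    (hφ : ∀ z : 𝔻, φ z = z * clarkTransform U hv (U.symm v) z) (n : ℕ) :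
    (modelFrame φ n : HardySpace) = clarkTransform U hv (kaczmarzFrame e n) := by
  obtain ⟨y, p, h⟩ := exists_monomial_eq_clarkTransform_add hv hφ n
  have hmem : monomial n - clarkTransform U hv y ∈ mulHardy φ := by
    refine ⟨p, fun z => ?_⟩
    rw [sub_eq_add_neg, ← neg_one_smul ℂ, add_apply, smul_apply, monomial_apply, h]
    ring
  have hproj : (modelFrame φ n : HardySpace) = clarkTransform U hv y :=
    Submodule.eq_starProjection_of_mem_orthogonal
      (clarkTransform_mem_modelSpace hv hM hφ y) (Submodule.le_orthogonal_orthogonal _ hmem)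
  rw [hproj]
  congr 1
  refine ext_inner_right ℂ fun x => ?_
  have h0 := Submodule.inner_right_of_mem_orthogonal hmem
    (clarkTransform_mem_modelSpace hv hM hφ x)
  rw [inner_sub_left, sub_eq_zero] at h0
  rw [← inner_clarkTransform hv hM, ← h0, inner_monomial, coeff_clarkTransform,
    inner_kaczmarzFrame_stationary he0 he]

theorem isEffective_stationary {e : ℕ → H} (hv : ‖v‖ = 1) (he0 : e 0 = v)
    (he : ∀ n, e (n + 1) = U (e n)) (hM : kaczmarzSubmodule U v = ⊤) : IsEffective e := by
  have hlim (x : H) : Tendsto (kaczmarzIter e x) atTop (𝓝 x) := by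
    rw [tendsto_iff_norm_sub_tendsto_zero]
    simp only [norm_sub_rev _ x, norm_sub_kaczmarzIter he0 he]
    have hx : x ∈ kaczmarzSubmodule U v := hM ▸ Submodule.mem_top
    exact (tendsto_add_atTop_iff_nat 1).2 (tendsto_zero_iff_norm_tendsto_zero.1 hx)
  refine ⟨norm_stationary he0 he hv, ?_, hlim⟩
  refine eq_top_iff.2 fun x _ => mem_closure_of_tendsto (hlim x) (Eventually.of_forall fun n => ?_)
  have hmem (n : ℕ) : e n ∈ Submodule.span ℂ (Set.range e) :=
    Submodule.subset_span (Set.mem_range_self n)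
  induction n with
  | zero => exact Submodule.smul_mem _ _ (hmem 0)
  | succ n ih => exact add_mem ih (Submodule.smul_mem _ _ (hmem (n + 1)))

theorem isParsevalFrame_kaczmarzFrame {e : ℕ → H} (hv : ‖v‖ = 1) (he0 : e 0 = v)
    (he : ∀ n, e (n + 1) = U (e n)) (hM : kaczmarzSubmodule U v = ⊤) :
    IsParsevalFrame (kaczmarzFrame e) := by
  intro x
  simpa only [inner_kaczmarzFrame_stationary he0 he, norm_clarkTransform hv hM,
    coeff_clarkTransform] using hasSum_norm_coeff_sq (clarkTransform U hv x)

/-- Where `φ` tends to one, the relation `V (U x) = z V x + ⟨U x, v⟩ (1 - φ)` lets `V eₙ` inherit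
the limit of `zⁿ`. -/
theorem tendsto_clarkTransform_stationary {e : ℕ → H} (he0 : e 0 = v)
    (he : ∀ n, e (n + 1) = U (e n))
    (hφ : ∀ z : 𝔻, φ z = z * clarkTransform U hv (U.symm v) z) {ω : ℂ} {l : Filter 𝔻}
    (hl : Tendsto (fun z : 𝔻 => (z : ℂ)) l (𝓝 ω)) (hφl : Tendsto φ l (𝓝 1)) (n : ℕ) :
    Tendsto (fun z => clarkTransform U hv (e n) z) l (𝓝 (ω ^ n)) := by
  induction n with
  | zero => simpa [he0, clarkTransform_self] using tendsto_const_nhds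
  | succ n ih =>
    simp only [he, clarkTransform_map hv hφ, pow_succ']
    simpa using (hl.mul ih).add
      (((tendsto_const_nhds (x := (1 : ℂ))).sub hφl).const_mul (inner ℂ v (U (e n))))

end Clark

/-! ### The generating function of the autocorrelation -/

section ClarkSymbol

open HardySpace

variable {H : Type*} [NormedAddCommGroup H] [InnerProductSpace ℂ H]
variable {U : H ≃ₗᵢ[ℂ] H} {v : H} {e : ℕ → H}

theorem inner_stationary_add (he0 : e 0 = v) (he : ∀ n, e (n + 1) = U (e n)) (j k : ℕ) :
    inner ℂ (e (j + k)) (e k) = inner ℂ (e j) v := by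
  induction k with
  | zero => rw [he0, add_zero]
  | succ k ih => rw [← add_assoc, he, he, LinearIsometryEquiv.inner_map_map, ih]

theorem inner_stationary_symm (he : ∀ n, e (n + 1) = U (e n)) (n : ℕ) :
    inner ℂ (e n) (U.symm v) = inner ℂ (e (n + 1)) v := by
  rw [he, ← LinearIsometryEquiv.inner_map_map U, LinearIsometryEquiv.apply_symm_apply]

/-- The moments of `x` are the convolution of its Kaczmarz coefficients with the autocorrelation
of the sequence `Uⁿ v`. -/
theorem inner_stationary_eq_sum (hv : ‖v‖ = 1) (he0 : e 0 = v) (he : ∀ n, e (n + 1) = U (e n))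
    (x : H) (n : ℕ) :
    inner ℂ (e n) x = ∑ k ∈ Finset.range (n + 1),
      coeff (clarkTransform U hv x) k * inner ℂ (e (n - k)) v := by
  have h := inner_stationary_map he0 he n (kaczmarzResidual U v n x)
  rw [iterate_kaczmarzResidual he0 he, inner_sub_right, inner_sum, sub_eq_iff_eq_add] at h
  rw [h, Finset.sum_range_succ, add_comm]
  congr 1
  · refine Finset.sum_congr rfl fun k hk => ?_
    have hk' : n - k + k = n := Nat.sub_add_cancel (Finset.mem_range.1 hk).le
    rw [inner_smul_right, coeff_clarkTransform, ← inner_stationary_add he0 he (n - k) k, hk']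
  · rw [Nat.sub_self, he0, inner_self_eq_norm_sq_to_K, hv, coeff_clarkTransform]
    simp

/-- The generating function `K` of the autocorrelation of `Uⁿ v` satisfies
`K - 1 = z V(U⁻¹ v) K`. -/
theorem sub_one_eq_mul_clarkTransform (hv : ‖v‖ = 1) (he0 : e 0 = v)
    (he : ∀ n, e (n + 1) = U (e n)) {z : 𝔻} {K : ℂ}
    (hK : HasSum (fun n => inner ℂ (e n) v * (z : ℂ) ^ n) K) :
    K - 1 = z * clarkTransform U hv (U.symm v) z * K := by
  have hgeo := summable_geometric_of_lt_one (norm_nonneg _) z.norm_lt_one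
  have hs1 : Summable fun n => ‖coeff (clarkTransform U hv (U.symm v)) n * (z : ℂ) ^ n‖ := by
    refine (hgeo.mul_left ‖clarkTransform U hv (U.symm v)‖).of_nonneg_of_le
      (fun n => norm_nonneg _) fun n => ?_
    rw [norm_mul, norm_pow]
    gcongr
    exact lp.norm_apply_le_norm two_ne_zero (coeff _) n
  have hs2 : Summable fun n => ‖inner ℂ (e n) v * (z : ℂ) ^ n‖ := by
    refine hgeo.of_nonneg_of_le (fun n => norm_nonneg _) fun n => ?_
    rw [norm_mul, norm_pow]
    refine mul_le_of_le_one_left (by positivity) ((norm_inner_le_norm _ _).trans ?_)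
    rw [norm_stationary he0 he hv, hv, one_mul]
  have hprod := tsum_mul_tsum_eq_tsum_sum_range_of_summable_norm hs1 hs2
  rw [(hasSum_coeff _ z).tsum_eq, hK.tsum_eq] at hprod
  have hshift := (hasSum_nat_add_iff' 1).2 hK
  have hz : HasSum (fun n => (z : ℂ) * (inner ℂ (e (n + 1)) v * (z : ℂ) ^ n)) (K - 1) := by
    convert! hshift using 1
    · funext n; ring
    · simp [he0, inner_self_eq_norm_sq_to_K, hv]
  rw [mul_assoc, hprod, ← tsum_mul_left, ← hz.tsum_eq]
  congr 1
  ext n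
  rw [← inner_stationary_symm he, inner_stationary_eq_sum hv he0 he, Finset.sum_mul]
  congr 1
  refine Finset.sum_congr rfl fun k hk => ?_
  have hk' : n - k + k = n := Nat.sub_add_cancel (Nat.lt_succ_iff.1 (Finset.mem_range.1 hk))
  have hz' : (z : ℂ) ^ n = (z : ℂ) ^ (n - k) * (z : ℂ) ^ k := by rw [← pow_add, hk']
  rw [hz']
  ring

end ClarkSymbol

/-! ### Multiplication by the coordinate on the circle -/

section CircleMul

variable (μ : Measure Circle)

variable {μ} in
theorem memLp_circleMul (h : C(Circle, Circle)) (f : Lp ℂ 2 μ) :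
    MemLp (fun ζ => (h ζ : ℂ) * f ζ) 2 μ := by
  refine (Lp.memLp f).congr_norm ?_ (Eventually.of_forall fun ζ => by simp [Circle.norm_coe])
  exact (by fun_prop : Continuous fun ζ => (h ζ : ℂ)).aestronglyMeasurable.mul
    (Lp.aestronglyMeasurable f)

/-- Multiplication by a continuous circle-valued function, as an isometry of `L²(μ)`. -/
def circleMul (h : C(Circle, Circle)) : Lp ℂ 2 μ →ₗᵢ[ℂ] Lp ℂ 2 μ :=
  { toFun := fun f => (memLp_circleMul h f).toLp
    map_add' := fun f g => by
      rw [← MemLp.toLp_add]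
      refine MemLp.toLp_congr _ _ ?_
      filter_upwards [Lp.coeFn_add f g] with ζ hζ
      rw [hζ, Pi.add_apply, mul_add, Pi.add_apply]
    map_smul' := fun c f => by
      rw [RingHom.id_apply, ← MemLp.toLp_const_smul]
      refine MemLp.toLp_congr _ _ ?_
      filter_upwards [Lp.coeFn_smul c f] with ζ hζ
      simp [hζ, mul_left_comm]
    norm_map' := fun f => by
      change ‖(memLp_circleMul h f).toLp‖ = ‖f‖
      rw [Lp.norm_toLp, Lp.norm_def]
      congr 1
      exact eLpNorm_congr_norm_ae (Eventually.of_forall fun ζ => by simp [Circle.norm_coe]) }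

variable {μ}

theorem coeFn_circleMul (h : C(Circle, Circle)) (f : Lp ℂ 2 μ) :
    circleMul μ h f =ᵐ[μ] fun ζ => (h ζ : ℂ) * f ζ :=
  (memLp_circleMul h f).coeFn_toLp

theorem circleMul_circleMul {h k : C(Circle, Circle)} (hk : ∀ ζ, h ζ * k ζ = 1)
    (f : Lp ℂ 2 μ) : circleMul μ h (circleMul μ k f) = f := by
  refine Lp.ext ?_
  filter_upwards [coeFn_circleMul h (circleMul μ k f), coeFn_circleMul k f] with ζ h1 h2
  rw [h1, h2, ← mul_assoc, ← Circle.coe_mul, hk, Circle.coe_one, one_mul]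

theorem circleMul_toLp [IsFiniteMeasure μ] (h : C(Circle, Circle)) (g k : C(Circle, ℂ))
    (hk : ∀ ζ, k ζ = h ζ * g ζ) :
    circleMul μ h (ContinuousMap.toLp 2 μ ℂ g) = ContinuousMap.toLp 2 μ ℂ k := by
  refine Lp.ext ?_
  filter_upwards [coeFn_circleMul h (ContinuousMap.toLp 2 μ ℂ g),
    ContinuousMap.coeFn_toLp (p := 2) (𝕜 := ℂ) μ g,
    ContinuousMap.coeFn_toLp (p := 2) (𝕜 := ℂ) μ k] with ζ h1 h2 h3
  rw [h1, h2, h3, hk]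

variable (μ) in
/-- Multiplication by the coordinate `ζ`, as a unitary operator on `L²(μ)`. -/
def coordMul : Lp ℂ 2 μ ≃ₗᵢ[ℂ] Lp ℂ 2 μ where
  toLinearEquiv := LinearEquiv.ofLinearMap
    (circleMul μ ⟨fun ζ => ζ, continuous_id⟩).toLinearMap
    (circleMul μ ⟨fun ζ => ζ⁻¹, continuous_inv⟩).toLinearMap
    (LinearMap.ext fun f => circleMul_circleMul (fun ζ => mul_inv_cancel ζ) f)
    (LinearMap.ext fun f => circleMul_circleMul (fun ζ => inv_mul_cancel ζ) f)
  norm_map' f := (circleMul μ ⟨fun ζ => ζ, continuous_id⟩).norm_map f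

variable [IsFiniteMeasure μ]

theorem coordMul_toLp {g k : C(Circle, ℂ)} (hk : ∀ ζ : Circle, k ζ = ζ * g ζ) :
    coordMul μ (ContinuousMap.toLp 2 μ ℂ g) = ContinuousMap.toLp 2 μ ℂ k :=
  circleMul_toLp _ g k hk

theorem coordMul_symm_toLp {g k : C(Circle, ℂ)} (hk : ∀ ζ : Circle, k ζ = (ζ : ℂ)⁻¹ * g ζ) :
    (coordMul μ).symm (ContinuousMap.toLp 2 μ ℂ g) = ContinuousMap.toLp 2 μ ℂ k :=
  circleMul_toLp _ g k fun ζ => by simp [hk]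

theorem circleMonomial_succ (n : ℕ) :
    circleMonomial μ (n + 1) = coordMul μ (circleMonomial μ n) :=
  (coordMul_toLp fun ζ => by simp [pow_succ']).symm

theorem norm_circleMonomial_zero (μ : Measure Circle) [IsProbabilityMeasure μ] :
    ‖circleMonomial μ 0‖ = 1 := by
  have h : inner ℂ (circleMonomial μ 0) (circleMonomial μ 0) = 1 := by
    rw [circleMonomial, ContinuousMap.inner_toLp]
    simp
  rw [inner_self_eq_norm_sq_to_K] at h
  have : ‖circleMonomial μ 0‖ ^ 2 = 1 := Complex.ofReal_injective (by simpa using h)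
  exact (pow_eq_one_iff_of_nonneg (norm_nonneg _) two_ne_zero).1 this

/-- A closed subspace of `L²(μ)` that contains the constants and is invariant under multiplication
by `ζ` and by `ζ⁻¹` is the whole space. -/
theorem eq_top_of_coordMul_mem {M : Submodule ℂ (Lp ℂ 2 μ)} (hM : IsClosed (M : Set (Lp ℂ 2 μ)))
    (h1 : circleMonomial μ 0 ∈ M) (hU : ∀ x ∈ M, coordMul μ x ∈ M)
    (hU' : ∀ x ∈ M, (coordMul μ).symm x ∈ M) : M = ⊤ := by
  let T : C(Circle, ℂ) →L[ℂ] Lp ℂ 2 μ := ContinuousMap.toLp 2 μ ℂ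
  -- The continuous multipliers of `M` form a self-adjoint algebra.
  let A : StarSubalgebra ℂ C(Circle, ℂ) :=
    { carrier := {f | ∀ g, T g ∈ M → T (f * g) ∈ M ∧ T (star f * g) ∈ M}
      mul_mem' := fun {f k} hf hk g hg => by
        refine ⟨?_, ?_⟩
        · rw [mul_assoc]; exact (hf _ (hk g hg).1).1
        · rw [star_mul, mul_assoc]; exact (hk _ (hf g hg).2).2
      add_mem' := fun {f k} hf hk g hg => by
        rw [star_add, add_mul, add_mul, map_add, map_add]
        exact ⟨add_mem (hf g hg).1 (hk g hg).1, add_mem (hf g hg).2 (hk g hg).2⟩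
      algebraMap_mem' := fun c g hg => by
        rw [← algebraMap_star_comm, ← Algebra.smul_def, ← Algebra.smul_def, map_smul, map_smul]
        exact ⟨M.smul_mem _ hg, M.smul_mem _ hg⟩
      star_mem' := fun {f} hf g hg => by
        rw [star_star]
        exact (hf g hg).symm }
  have hid : (⟨fun ζ : Circle => (ζ : ℂ), by fun_prop⟩ : C(Circle, ℂ)) ∈ A := fun g hg =>
    ⟨coordMul_toLp (μ := μ) (g := g) (k := ⟨fun ζ : Circle => (ζ : ℂ), by fun_prop⟩ * g)
        (fun ζ => rfl) ▸ hU _ hg,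
      coordMul_symm_toLp (μ := μ) (g := g)
        (k := star ⟨fun ζ : Circle => (ζ : ℂ), by fun_prop⟩ * g) (fun ζ => by
          change starRingEnd ℂ (ζ : ℂ) * g ζ = _
          rw [← Circle.coe_inv_eq_conj, Circle.coe_inv]) ▸ hU' _ hg⟩
  have hA := ContinuousMap.starSubalgebra_topologicalClosure_eq_top_of_separatesPoints A
    fun x y hxy => ⟨_, ⟨_, hid, rfl⟩, fun h => hxy (Circle.ext h)⟩
  have hT (f : C(Circle, ℂ)) : T f ∈ M := by
    have hf : f ∈ closure (A : Set C(Circle, ℂ)) := by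
      rw [← StarSubalgebra.topologicalClosure_coe, hA]; trivial
    refine closure_minimal (fun k hk => ?_) (hM.preimage T.continuous) hf
    have h1' : T 1 ∈ M := by
      convert h1 using 1
      refine congrArg T ?_
      ext ζ
      simp
    simpa using (hk 1 h1').1
  have hdense : DenseRange T := ContinuousMap.toLp_denseRange ℂ μ ℂ (by norm_num)
  refine eq_top_iff.2 fun x _ => ?_
  exact closure_minimal (Set.range_subset_iff.2 hT) hM (hdense x)

end CircleMul

/-! ### The symbol attached to a measure -/

section Symbol

open HardySpace

variable (μ : Measure Circle) [IsProbabilityMeasure μ]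

/-- The Herglotz transform is `2 K - 1`, where `K` is the Cauchy transform of `μ`, the generating
function of its moments. -/
theorem hasSum_inner_circleMonomial (z : 𝔻) :
    HasSum (fun n => inner ℂ (circleMonomial μ n) (circleMonomial μ 0) * (z : ℂ) ^ n)
      ((herglotz μ z + 1) / 2) := by
  have hne (ζ : Circle) : (ζ : ℂ) - z ≠ 0 := fun h => by
    have := z.norm_lt_one
    rw [← sub_eq_zero.1 h, Circle.norm_coe] at this
    exact lt_irrefl _ this
  have hint : Integrable (fun ζ : Circle => ((ζ : ℂ) + z) / ((ζ : ℂ) - z)) μ := by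
    refine Continuous.integrable_of_hasCompactSupport ?_ (HasCompactSupport.of_compactSpace _)
    exact (by fun_prop : Continuous fun ζ : Circle => (ζ : ℂ) + z).div (by fun_prop) hne
  have h1 : (herglotz μ z + 1) / 2 = ∫ ζ : Circle, (1 - (z : ℂ) * (ζ : ℂ)⁻¹)⁻¹ ∂μ := by
    have : herglotz μ z + 1 = ∫ ζ : Circle, (((ζ : ℂ) + z) / ((ζ : ℂ) - z) + 1) ∂μ := by
      rw [integral_add hint (integrable_const _)]
      simp [herglotz]
    rw [this, ← integral_div]
    refine integral_congr_ae (Eventually.of_forall fun ζ => ?_)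
    have h0 : (ζ : ℂ) ≠ 0 := Circle.coe_ne_zero ζ
    have := hne ζ
    have h2 : 1 - (z : ℂ) * (ζ : ℂ)⁻¹ = ((ζ : ℂ) - z) / ζ := by field_simp
    simp only [h2]
    field_simp
    ring
  rw [h1]
  have hgeo := summable_geometric_of_lt_one (norm_nonneg _) z.norm_lt_one
  have hnorm (ζ : Circle) : ‖(z : ℂ) * (ζ : ℂ)⁻¹‖ = ‖(z : ℂ)‖ := by
    rw [norm_mul, norm_inv, Circle.norm_coe, inv_one, mul_one]
  have hF : HasSum (fun n => ∫ ζ : Circle, ((z : ℂ) * (ζ : ℂ)⁻¹) ^ n ∂μ)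
      (∫ ζ : Circle, ∑' n, ((z : ℂ) * (ζ : ℂ)⁻¹) ^ n ∂μ) := by
    refine hasSum_integral_of_summable_integral_norm (fun n => ?_) ?_
    · refine Continuous.integrable_of_hasCompactSupport ?_ (HasCompactSupport.of_compactSpace _)
      exact (continuous_const.mul ((by fun_prop : Continuous fun ζ : Circle => (ζ : ℂ)).inv₀
        Circle.coe_ne_zero)).pow n
    · simpa only [norm_pow, hnorm, integral_const, probReal_univ, one_smul] using hgeo
  convert! hF using 2 with n
  · rw [circleMonomial, circleMonomial, ContinuousMap.inner_toLp, ← integral_mul_const]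
    refine integral_congr_ae (Eventually.of_forall fun ζ => ?_)
    simp [← Circle.coe_inv_eq_conj, mul_pow, mul_comm]
  · funext ζ
    exact (tsum_geometric_of_norm_lt_one ((hnorm ζ).trans_lt z.norm_lt_one)).symm

/-- The vector of the Hardy space which as a function is `(ψ - 1) / (ψ + 1)`. -/
def clarkSymbol : HardySpace :=
  shift (clarkTransform (coordMul μ) (norm_circleMonomial_zero μ)
    ((coordMul μ).symm (circleMonomial μ 0)))

theorem herglotz_add_one_ne_zero (z : 𝔻) : herglotz μ z + 1 ≠ 0 := fun h => by
  have := sub_one_eq_mul_clarkTransform (norm_circleMonomial_zero μ) rfl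
    circleMonomial_succ (hasSum_inner_circleMonomial μ z)
  simp [h] at this

theorem clarkFunction_eq_clarkSymbol (z : 𝔻) : clarkFunction μ z = clarkSymbol μ z := by
  have h := sub_one_eq_mul_clarkTransform (norm_circleMonomial_zero μ) rfl
    circleMonomial_succ (hasSum_inner_circleMonomial μ z)
  have h0 := herglotz_add_one_ne_zero μ z
  rw [clarkFunction, div_eq_iff h0, clarkSymbol, shift_apply]
  linear_combination 2 * h

theorem clarkFunction_mem_hardySubmodule : clarkFunction μ ∈ hardySubmodule :=
  (funext (clarkFunction_eq_clarkSymbol μ) : clarkFunction μ = (clarkSymbol μ).1) ▸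
    (clarkSymbol μ).2

/-- As `φ = z V(U⁻¹ v)`, the norm of `φ` decides whether the Kaczmarz algorithm recovers `U⁻¹ v`,
the function `ζ⁻¹`, and with it every vector. -/
theorem kaczmarzSubmodule_eq_top (h : ‖clarkSymbol μ‖ = 1) :
    kaczmarzSubmodule (coordMul μ) (circleMonomial μ 0) = ⊤ := by
  have hv := norm_circleMonomial_zero μ
  have hmem : (coordMul μ).symm (circleMonomial μ 0) ∈
      kaczmarzSubmodule (coordMul μ) (circleMonomial μ 0) := by
    rw [mem_kaczmarzSubmodule_iff hv, LinearIsometryEquiv.norm_map, hv, ← h, clarkSymbol,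
      norm_shift]
  exact eq_top_of_coordMul_mem (isClosed_kaczmarzSubmodule hv) (self_mem_kaczmarzSubmodule hv)
    (fun x hx => map_mem_kaczmarzSubmodule hmem hx)
    (fun x hx => symm_map_mem_kaczmarzSubmodule hmem hx)

end Symbol

/-! ### Stolz regions and the Poisson kernel -/

/-- Approach to `ω` inside the Stolz region of aperture `M`. -/
def stolz (ω : Circle) (M : ℝ) : Filter 𝔻 :=
  comap (fun z : 𝔻 => (z : ℂ)) (𝓝 (ω : ℂ)) ⊓
    𝓟 {z : 𝔻 | ‖(z : ℂ) - (ω : ℂ)‖ < M * (1 - ‖(z : ℂ)‖)}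

theorem tendsto_coe_stolz (ω : Circle) (M : ℝ) :
    Tendsto (fun z : 𝔻 => (z : ℂ)) (stolz ω M) (𝓝 (ω : ℂ)) :=
  tendsto_comap.mono_left inf_le_left

theorem tendsto_one_sub_norm_stolz (ω : Circle) (M : ℝ) :
    Tendsto (fun z : 𝔻 => 1 - ‖(z : ℂ)‖) (stolz ω M) (𝓝[>] 0) := by
  refine tendsto_nhdsWithin_iff.2 ⟨?_, Eventually.of_forall fun z => sub_pos.2 z.norm_lt_one⟩
  simpa [Circle.norm_coe] using (tendsto_coe_stolz ω M).norm.const_sub 1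

theorem eventually_stolz (ω : Circle) (M : ℝ) :
    ∀ᶠ z : 𝔻 in stolz ω M, ‖(z : ℂ) - (ω : ℂ)‖ < M * (1 - ‖(z : ℂ)‖) :=
  eventually_inf_principal.2 (Eventually.of_forall fun _ h => h)

theorem stolz_two_neBot (ω : Circle) : (stolz ω 2).NeBot := by
  have hnorm {r : ℝ} (hr : r ∈ Set.Ioo (0 : ℝ) 1) : ‖(r : ℂ) * ω‖ = r := by
    rw [norm_mul, Circle.norm_coe, mul_one, Complex.norm_real, Real.norm_of_nonneg hr.1.le]
  -- The radius that ends at `ω` lies in the Stolz region.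
  let γ : ℝ → 𝔻 := fun r => if hr : r ∈ Set.Ioo (0 : ℝ) 1 then
    Complex.UnitDisc.mk (r * ω) ((hnorm hr).trans_lt hr.2) else 0
  have hγ {r : ℝ} (hr : r ∈ Set.Ioo (0 : ℝ) 1) : (γ r : ℂ) = r * ω := by
    simp only [γ, dif_pos hr]
    rfl
  have hmem : Set.Ioo (0 : ℝ) 1 ∈ 𝓝[<] (1 : ℝ) := Ioo_mem_nhdsLT one_pos
  have ht : Tendsto γ (𝓝[<] 1) (stolz ω 2) := by
    refine tendsto_inf.2 ⟨tendsto_comap_iff.2 ?_, tendsto_principal.2 ?_⟩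
    · have : Tendsto (fun r : ℝ => (r : ℂ) * ω) (𝓝[<] 1) (𝓝 (ω : ℂ)) := by
        have : Continuous fun r : ℝ => (r : ℂ) * ω := by fun_prop
        simpa using (this.tendsto 1).mono_left nhdsWithin_le_nhds
      refine this.congr' ?_
      filter_upwards [hmem] with r hr using (hγ hr).symm
    · filter_upwards [hmem] with r hr
      have h1 : (r : ℂ) * ω - ω = ((r - 1 : ℝ) : ℂ) * ω := by push_cast; ring
      rw [hγ hr, hnorm hr, h1, norm_mul, Circle.norm_coe, Complex.norm_real,
        Real.norm_eq_abs, abs_of_neg (by linarith [hr.2])]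
      linarith [hr.2]
  exact ht.neBot

section PoissonKernel

variable (z : 𝔻) (ζ ω : Circle)

theorem poissonKernel_circle :
    poissonKernel 0 (z : ℂ) (ζ : ℂ) = (1 - ‖(z : ℂ)‖ ^ 2) / ‖(ζ : ℂ) - z‖ ^ 2 := by
  rw [poissonKernel_def]
  simp [Circle.norm_coe]

theorem one_sub_norm_le_norm_sub : 1 - ‖(z : ℂ)‖ ≤ ‖(ζ : ℂ) - z‖ := by
  have := norm_sub_norm_le (ζ : ℂ) z
  rwa [Circle.norm_coe] at this

theorem norm_circle_sub_pos : 0 < ‖(ζ : ℂ) - z‖ :=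
  (sub_pos.2 z.norm_lt_one).trans_le (one_sub_norm_le_norm_sub z ζ)

theorem poissonKernel_circle_nonneg : 0 ≤ poissonKernel 0 (z : ℂ) (ζ : ℂ) := by
  rw [poissonKernel_circle]
  have := z.sq_norm_lt_one
  exact div_nonneg (by linarith) (by positivity)

theorem continuous_poissonKernel_circle :
    Continuous fun ζ : Circle => poissonKernel 0 (z : ℂ) (ζ : ℂ) := by
  simp only [poissonKernel_circle]
  exact continuous_const.div (by fun_prop) fun ζ => (pow_pos (norm_circle_sub_pos z ζ) 2).ne'

theorem integrable_poissonKernel_circle (ν : Measure Circle) [IsFiniteMeasure ν] :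
    Integrable (fun ζ : Circle => poissonKernel 0 (z : ℂ) (ζ : ℂ)) ν :=
  (continuous_poissonKernel_circle z).integrable_of_hasCompactSupport
    (HasCompactSupport.of_compactSpace _)

variable {z ζ ω}

/-- Near the vertex of a Stolz region the Poisson kernel is large. -/
theorem le_poissonKernel_of_dist_le {M : ℝ}
    (hz : ‖(z : ℂ) - (ω : ℂ)‖ < M * (1 - ‖(z : ℂ)‖)) (hζ : dist ζ ω ≤ 1 - ‖(z : ℂ)‖) :
    ((1 + M) ^ 2 * (1 - ‖(z : ℂ)‖))⁻¹ ≤ poissonKernel 0 (z : ℂ) (ζ : ℂ) := by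
  have hh : 0 < 1 - ‖(z : ℂ)‖ := sub_pos.2 z.norm_lt_one
  have hd : dist ζ ω = ‖(ζ : ℂ) - ω‖ := dist_eq_norm (ζ : ℂ) (ω : ℂ)
  have h1 : ‖(ζ : ℂ) - z‖ ≤ (1 + M) * (1 - ‖(z : ℂ)‖) := by
    have := norm_sub_le_norm_sub_add_norm_sub (ζ : ℂ) ω z
    rw [norm_sub_rev (ω : ℂ) z] at this
    linarith
  have hpos := norm_circle_sub_pos z ζ
  rw [poissonKernel_circle, le_div_iff₀ (by positivity)]
  have h2 : ‖(ζ : ℂ) - z‖ ^ 2 ≤ ((1 + M) * (1 - ‖(z : ℂ)‖)) ^ 2 := by gcongr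
  have hM : 0 < 1 + M := by nlinarith
  calc ((1 + M) ^ 2 * (1 - ‖(z : ℂ)‖))⁻¹ * ‖(ζ : ℂ) - z‖ ^ 2
      ≤ ((1 + M) ^ 2 * (1 - ‖(z : ℂ)‖))⁻¹ * ((1 + M) * (1 - ‖(z : ℂ)‖)) ^ 2 := by gcongr
    _ = 1 - ‖(z : ℂ)‖ := by field_simp
    _ ≤ 1 - ‖(z : ℂ)‖ ^ 2 := by nlinarith [norm_nonneg (z : ℂ)]

/-- Inside a Stolz region the Poisson kernel is dominated by a dyadic sum of averages over balls
around the vertex. -/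
theorem poissonKernel_le_of_dist_le {M : ℝ}
    (hz : ‖(z : ℂ) - (ω : ℂ)‖ < M * (1 - ‖(z : ℂ)‖)) :
    ∃ k : ℕ, dist ζ ω ≤ 2 ^ k * (1 - ‖(z : ℂ)‖) ∧
      poissonKernel 0 (z : ℂ) (ζ : ℂ) ≤ 8 * (1 + M) ^ 2 * (1 / 2) ^ k /
        (2 ^ k * (1 - ‖(z : ℂ)‖)) := by
  have hh : 0 < 1 - ‖(z : ℂ)‖ := sub_pos.2 z.norm_lt_one
  set h := 1 - ‖(z : ℂ)‖ with hdef
  have hd : dist ζ ω = ‖(ζ : ℂ) - ω‖ := dist_eq_norm (ζ : ℂ) (ω : ℂ)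
  have hpos := norm_circle_sub_pos z ζ
  have hle : h ≤ ‖(ζ : ℂ) - z‖ := one_sub_norm_le_norm_sub z ζ
  have hM0 : 0 < M := by
    by_contra hM
    nlinarith [norm_nonneg ((z : ℂ) - (ω : ℂ))]
  have h1 : dist ζ ω ≤ (1 + M) * ‖(ζ : ℂ) - z‖ := by
    have := norm_sub_le_norm_sub_add_norm_sub (ζ : ℂ) z ω
    nlinarith
  have hker : poissonKernel 0 (z : ℂ) (ζ : ℂ) ≤ 2 * h / ‖(ζ : ℂ) - z‖ ^ 2 := by
    rw [poissonKernel_circle]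
    gcongr
    nlinarith [norm_nonneg (z : ℂ), z.norm_lt_one]
  -- It suffices to bound the distance `|ζ - z|` from below by `2 ^ k h`, up to a constant.
  have key (k : ℕ) (hk : 2 ^ k * h ≤ 2 * ((1 + M) * ‖(ζ : ℂ) - z‖)) :
      poissonKernel 0 (z : ℂ) (ζ : ℂ) ≤ 8 * (1 + M) ^ 2 * (1 / 2) ^ k / (2 ^ k * h) := by
    refine hker.trans ?_
    have h2 : (2 ^ k * h) ^ 2 ≤ (2 * ((1 + M) * ‖(ζ : ℂ) - z‖)) ^ 2 := by gcongr
    rw [div_le_div_iff₀ (by positivity) (by positivity)]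
    have h3 : (1 / 2 : ℝ) ^ k * 2 ^ k = 1 := by rw [← mul_pow]; norm_num
    have h4 : 2 * h * (2 ^ k * h) = 2 * ((1 / 2 : ℝ) ^ k) * (2 ^ k * h) ^ 2 := by
      linear_combination (-2 * h ^ 2 * 2 ^ k) * h3
    rw [h4]
    calc 2 * ((1 / 2 : ℝ) ^ k) * (2 ^ k * h) ^ 2
        ≤ 2 * ((1 / 2 : ℝ) ^ k) * (2 * ((1 + M) * ‖(ζ : ℂ) - z‖)) ^ 2 := by gcongr
      _ = _ := by ring
  rcases le_or_gt (dist ζ ω) h with hζ | hζ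
  · exact ⟨0, by simpa using hζ, key 0 (by nlinarith)⟩
  · obtain ⟨k, hk1, hk2⟩ := exists_nat_pow_near (one_le_div hh |>.2 hζ.le) one_lt_two
    rw [le_div_iff₀ hh] at hk1
    rw [div_lt_iff₀ hh] at hk2
    refine ⟨k + 1, hk2.le, key (k + 1) ?_⟩
    rw [pow_succ]
    linarith

end PoissonKernel

section PoissonIntegral

variable {ν : Measure Circle} [IsFiniteMeasure ν] {ω : Circle}

/-- If the density of a measure at `ω` vanishes, then its Poisson integral has the nontangential
limit zero at `ω`. -/
theorem tendsto_poissonIntegral_zero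
    (hν : Tendsto (fun r => ν.real (Metric.closedBall ω r) / r) (𝓝[>] 0) (𝓝 0)) (M : ℝ) :
    Tendsto (fun z : 𝔻 => ∫ ζ : Circle, poissonKernel 0 (z : ℂ) (ζ : ℂ) ∂ν) (stolz ω M) (𝓝 0) := by
  set q : ℝ → ℝ := fun r => ν.real (Metric.closedBall ω r) / r
  have hq0 {r : ℝ} (hr : 0 < r) : 0 ≤ q r := by positivity
  obtain ⟨C, hC⟩ : ∃ C, ∀ r, 0 < r → q r ≤ C := by
    obtain ⟨δ, hδ, h⟩ := (mem_nhdsGT_iff_exists_Ioo_subset.1 (hν.eventually_lt_const one_pos))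
    replace hδ : 0 < δ := hδ
    refine ⟨max 1 (ν.real Set.univ / δ), fun r hr => ?_⟩
    rcases lt_or_ge r δ with hrδ | hrδ
    · exact le_max_of_le_left (h ⟨hr, hrδ⟩ : q r < 1).le
    · refine le_max_of_le_right ?_
      simp only [q]
      have : ν.real (Metric.closedBall ω r) ≤ ν.real Set.univ :=
        measureReal_mono (Set.subset_univ _)
      gcongr
  -- The dyadic sum tends to zero with `h` by dominated convergence, its terms being at most
  -- `C` times those of a geometric series.
  let S : ℝ → ℝ := fun h => ∑' k : ℕ, 8 * (1 + M) ^ 2 * (1 / 2) ^ k * q (2 ^ k * h)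
  have hbound {h : ℝ} (hh : 0 < h) (k : ℕ) : ‖8 * (1 + M) ^ 2 * (1 / 2) ^ k * q (2 ^ k * h)‖ ≤
      8 * (1 + M) ^ 2 * (1 / 2) ^ k * C := by
    rw [Real.norm_of_nonneg (mul_nonneg (by positivity) (hq0 (by positivity)))]
    gcongr
    exact hC _ (by positivity)
  have hsum : Summable fun k : ℕ => 8 * (1 + M) ^ 2 * (1 / 2 : ℝ) ^ k * C :=
    ((summable_geometric_of_lt_one (by norm_num) (by norm_num)).mul_left _).mul_right _
  have hS : Tendsto S (𝓝[>] 0) (𝓝 0) := by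
    have := tendsto_tsum_of_dominated_convergence (𝓕 := 𝓝[>] (0 : ℝ))
      (f := fun h (k : ℕ) => 8 * (1 + M) ^ 2 * (1 / 2) ^ k * q (2 ^ k * h)) (g := fun _ => (0 : ℝ))
      hsum (fun k => ?_) ?_
    · simpa only [tsum_zero] using this
    · have hk : Tendsto (fun h : ℝ => 2 ^ k * h) (𝓝[>] 0) (𝓝[>] 0) := by
        refine tendsto_nhdsWithin_iff.2 ⟨?_, ?_⟩
        · have : Continuous fun h : ℝ => 2 ^ k * h := by fun_prop
          simpa using (this.tendsto 0).mono_left nhdsWithin_le_nhds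
        · filter_upwards [self_mem_nhdsWithin] with h hh
          exact mul_pos (pow_pos two_pos k : (0 : ℝ) < 2 ^ k) hh
      have hq := (hν.comp hk).const_mul (8 * (1 + M) ^ 2 * (1 / 2 : ℝ) ^ k)
      rwa [mul_zero] at hq
    · filter_upwards [self_mem_nhdsWithin] with h hh
      exact hbound hh
  refine squeeze_zero' (Eventually.of_forall fun z => integral_nonneg fun ζ =>
    poissonKernel_circle_nonneg z ζ) ?_ (hS.comp (tendsto_one_sub_norm_stolz ω M))
  filter_upwards [eventually_stolz ω M] with z hz
  have hh : 0 < 1 - ‖(z : ℂ)‖ := sub_pos.2 z.norm_lt_one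
  set h := 1 - ‖(z : ℂ)‖
  have hSnn (k : ℕ) : 0 ≤ 8 * (1 + M) ^ 2 * (1 / 2) ^ k * q (2 ^ k * h) :=
    mul_nonneg (by positivity) (hq0 (by positivity))
  have hball (k : ℕ) : MeasurableSet (Metric.closedBall ω (2 ^ k * h)) :=
    Metric.isClosed_closedBall.measurableSet
  change _ ≤ S h
  rw [← ENNReal.ofReal_le_ofReal_iff (tsum_nonneg hSnn),
    ofReal_integral_eq_lintegral_ofReal (integrable_poissonKernel_circle z ν)
      (Eventually.of_forall fun ζ => poissonKernel_circle_nonneg z ζ)]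
  calc ∫⁻ ζ : Circle, ENNReal.ofReal (poissonKernel 0 (z : ℂ) (ζ : ℂ)) ∂ν
      ≤ ∫⁻ ζ : Circle, ∑' k : ℕ, (Metric.closedBall ω (2 ^ k * h)).indicator
          (fun _ => ENNReal.ofReal (8 * (1 + M) ^ 2 * (1 / 2) ^ k / (2 ^ k * h))) ζ ∂ν := by
        refine lintegral_mono fun ζ => ?_
        obtain ⟨k, hk, hle⟩ := poissonKernel_le_of_dist_le (ζ := ζ) hz
        refine le_trans ?_ (ENNReal.le_tsum k)
        rw [Set.indicator_of_mem (Metric.mem_closedBall.2 hk)]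
        exact ENNReal.ofReal_le_ofReal hle
    _ = ∑' k : ℕ, ENNReal.ofReal (8 * (1 + M) ^ 2 * (1 / 2) ^ k * q (2 ^ k * h)) := by
        rw [lintegral_tsum fun k => (measurable_const.indicator (hball k)).aemeasurable]
        congr 1
        ext k
        rw [lintegral_indicator_const (hball k), ← ENNReal.ofReal_toReal (measure_ne_top ν _),
          ← ENNReal.ofReal_mul (by positivity)]
        congr 1
        simp only [q, measureReal_def]
        ring
    _ = ENNReal.ofReal (S h) :=
        (ENNReal.ofReal_tsum_of_nonneg hSnn (hsum.of_norm_bounded (hbound hh))).symm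

/-- The Poisson integral dominates the averages over balls around the vertex of a Stolz region. -/
theorem le_poissonIntegral {z : 𝔻} {M : ℝ} (hz : ‖(z : ℂ) - (ω : ℂ)‖ < M * (1 - ‖(z : ℂ)‖)) :
    ((1 + M) ^ 2)⁻¹ * (ν.real (Metric.closedBall ω (1 - ‖(z : ℂ)‖)) / (1 - ‖(z : ℂ)‖)) ≤
      ∫ ζ : Circle, poissonKernel 0 (z : ℂ) (ζ : ℂ) ∂ν := by
  have hball : MeasurableSet (Metric.closedBall ω (1 - ‖(z : ℂ)‖)) :=
    Metric.isClosed_closedBall.measurableSet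
  calc ((1 + M) ^ 2)⁻¹ * (ν.real (Metric.closedBall ω (1 - ‖(z : ℂ)‖)) / (1 - ‖(z : ℂ)‖))
      = ((1 + M) ^ 2 * (1 - ‖(z : ℂ)‖))⁻¹ * ν.real (Metric.closedBall ω (1 - ‖(z : ℂ)‖)) := by
        rw [mul_inv]; ring
    _ ≤ ∫ ζ in Metric.closedBall ω (1 - ‖(z : ℂ)‖), poissonKernel 0 (z : ℂ) (ζ : ℂ) ∂ν := by
        refine setIntegral_ge_of_const_le_real hball (measure_ne_top _ _) (fun ζ hζ => ?_)
          (integrable_poissonKernel_circle z ν).integrableOn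
        exact le_poissonKernel_of_dist_le hz hζ
    _ ≤ ∫ ζ : Circle, poissonKernel 0 (z : ℂ) (ζ : ℂ) ∂ν :=
        setIntegral_le_integral (integrable_poissonKernel_circle z ν)
          (Eventually.of_forall fun ζ => poissonKernel_circle_nonneg z ζ)

/-- If the density of a measure at `ω` is infinite, then its Poisson integral tends to infinity
nontangentially at `ω`. -/
theorem tendsto_poissonIntegral_atTop
    (hν : Tendsto (fun r => ν.real (Metric.closedBall ω r) / r) (𝓝[>] 0) atTop) (M : ℝ) :
    Tendsto (fun z : 𝔻 => ∫ ζ : Circle, poissonKernel 0 (z : ℂ) (ζ : ℂ) ∂ν) (stolz ω M) atTop := by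
  rcases eq_or_ne (stolz ω M) ⊥ with hbot | hbot
  · rw [hbot]; exact tendsto_bot
  have : (stolz ω M).NeBot := ⟨hbot⟩
  obtain ⟨z₀, hz₀⟩ := (eventually_stolz ω M).exists
  have hM : 0 < 1 + M := by
    nlinarith [norm_nonneg ((z₀ : ℂ) - (ω : ℂ)), z₀.norm_lt_one]
  have h1 := (hν.comp (tendsto_one_sub_norm_stolz ω M)).const_mul_atTop
    (inv_pos.2 (pow_pos hM 2))
  refine tendsto_atTop_mono' _ ?_ h1
  filter_upwards [eventually_stolz ω M] with z hz using le_poissonIntegral hz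

end PoissonIntegral

/-! ### Lebesgue measure on the circle -/

instance circleLebesgue_isProbabilityMeasure : IsProbabilityMeasure circleLebesgue := by
  refine ⟨?_⟩
  have h : ENNReal.ofReal (2 * Real.pi) ≠ 0 := by
    simpa using Real.pi_pos
  rw [circleLebesgue, Measure.smul_apply, Measure.map_apply (by fun_prop) MeasurableSet.univ,
    Set.preimage_univ, Measure.restrict_apply_univ, Real.volume_Ioc, sub_zero, smul_eq_mul,
    ENNReal.inv_mul_cancel h ENNReal.ofReal_ne_top]

theorem integral_circleLebesgue {E : Type*} [NormedAddCommGroup E] [NormedSpace ℝ E] {f : ℂ → E}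
    (hf : Continuous fun ζ : Circle => f ζ) :
    ∫ ζ : Circle, f ζ ∂circleLebesgue = Real.circleAverage f 0 1 := by
  rw [circleLebesgue, integral_smul_measure, integral_map (by fun_prop)
    hf.aestronglyMeasurable, Real.circleAverage_def,
    intervalIntegral.integral_of_le Real.two_pi_pos.le, ENNReal.toReal_inv,
    ENNReal.toReal_ofReal Real.two_pi_pos.le]
  simp [circleMap]

/-- The Poisson integral of a monomial. -/
theorem integral_poissonKernel_smul_pow (z : 𝔻) (n : ℕ) :
    ∫ ζ : Circle, poissonKernel 0 (z : ℂ) (ζ : ℂ) • (ζ : ℂ) ^ n ∂circleLebesgue = (z : ℂ) ^ n := by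
  rw [integral_circleLebesgue (f := fun w => poissonKernel 0 (z : ℂ) w • w ^ n)
    ((continuous_poissonKernel_circle z).smul (by fun_prop))]
  exact DiffContOnCl.circleAverage_poissonKernel_smul (f := fun w : ℂ => w ^ n)
    (Differentiable.diffContOnCl (by fun_prop)) (by simpa using z.norm_lt_one)

theorem integral_poissonKernel_circleLebesgue (z : 𝔻) :
    ∫ ζ : Circle, poissonKernel 0 (z : ℂ) (ζ : ℂ) ∂circleLebesgue = 1 := by
  have h := integral_poissonKernel_smul_pow z 0
  simp only [pow_zero, Complex.real_smul, mul_one] at h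
  exact Complex.ofReal_injective (integral_ofReal.symm.trans h)

theorem orthonormal_circleMonomial : Orthonormal ℂ (circleMonomial circleLebesgue) := by
  have hv := norm_circleMonomial_zero circleLebesgue
  have h0 (j k : ℕ) : inner ℂ (circleMonomial circleLebesgue (j + 1 + k))
      (circleMonomial circleLebesgue k) = 0 := by
    rw [inner_stationary_add rfl circleMonomial_succ, ← inner_eq_zero_symm, circleMonomial,
      circleMonomial, ContinuousMap.inner_toLp]
    have hker (ζ : Circle) : poissonKernel 0 ((0 : 𝔻) : ℂ) (ζ : ℂ) = 1 := by
      rw [poissonKernel_circle]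
      simp [Circle.norm_coe]
    have := integral_poissonKernel_smul_pow 0 (j + 1)
    simp only [hker] at this
    simpa using this
  refine ⟨norm_stationary rfl circleMonomial_succ hv, fun m n hmn => ?_⟩
  rcases lt_or_gt_of_ne hmn with h | h
  · obtain ⟨k, rfl⟩ := Nat.exists_eq_add_of_lt h
    rw [← inner_eq_zero_symm, add_assoc, add_comm]
    exact h0 k m
  · obtain ⟨k, rfl⟩ := Nat.exists_eq_add_of_lt h
    rw [add_assoc, add_comm]
    exact h0 k n

theorem circleLebesgue_closedBall_le (ω : Circle) {r : ℝ} (hr : 0 < r) (hr1 : r < 1) :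
    circleLebesgue.real (Metric.closedBall ω r) ≤ 9 * r := by
  have hnorm : ‖((1 - r : ℝ) : ℂ) * ω‖ = 1 - r := by
    rw [norm_mul, Circle.norm_coe, mul_one, Complex.norm_real, Real.norm_of_nonneg (by linarith)]
  -- The Poisson kernel of the point at distance `r` from `ω` has integral one.
  let z : 𝔻 := Complex.UnitDisc.mk (((1 - r : ℝ) : ℂ) * ω) (by rw [hnorm]; linarith)
  have hz : (z : ℂ) = ((1 - r : ℝ) : ℂ) * ω := rfl
  have hzr : 1 - ‖(z : ℂ)‖ = r := by rw [hz, hnorm]; ring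
  have hsub : (z : ℂ) - ω = ((-r : ℝ) : ℂ) * ω := by rw [hz]; push_cast; ring
  have h := le_poissonIntegral (ν := circleLebesgue) (ω := ω) (z := z) (M := 2) (by
    rw [hzr, hsub, norm_mul, Circle.norm_coe, Complex.norm_real, Real.norm_eq_abs, abs_neg,
      abs_of_pos hr]
    linarith)
  rw [integral_poissonKernel_circleLebesgue, hzr, ← div_eq_inv_mul, div_div,
    div_le_one (by positivity)] at h
  linarith

theorem le_circleLebesgue_closedBall (ω : Circle) {r : ℝ} (hr : 0 < r) (hr1 : r < 1) :
    (2 * Real.pi)⁻¹ * r ≤ circleLebesgue.real (Metric.closedBall ω r) := by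
  have hpi := Real.pi_gt_three
  obtain ⟨θ, hθ, rfl⟩ : ∃ θ ∈ Set.Ioc 0 (2 * Real.pi), Circle.exp θ = ω := by
    rcases le_or_gt (Complex.arg ω) 0 with h | h
    · refine ⟨Complex.arg ω + 2 * Real.pi, ⟨?_, by linarith⟩, ?_⟩
      · linarith [Complex.neg_pi_lt_arg (ω : ℂ)]
      · rw [Circle.exp_add_two_pi, Circle.exp_arg]
    · exact ⟨Complex.arg ω, ⟨h, by linarith [Complex.arg_le_pi (ω : ℂ)]⟩, Circle.exp_arg ω⟩
  have hdist (s : ℝ) : dist (Circle.exp s) (Circle.exp θ) ≤ |s - θ| := by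
    have h1 : dist (Circle.exp s) (Circle.exp θ) =
        ‖(Circle.exp s : ℂ) - (Circle.exp θ : ℂ)‖ := dist_eq_norm (Circle.exp s : ℂ) _
    have h2 : (Circle.exp s : ℂ) - (Circle.exp θ : ℂ) =
        (Circle.exp θ : ℂ) * (Complex.exp (Complex.I * ((s - θ : ℝ) : ℂ)) - 1) := by
      rw [mul_sub, mul_one, Circle.coe_exp, Circle.coe_exp, ← Complex.exp_add]
      congr 2
      push_cast
      ring
    rw [h1, h2, norm_mul, Circle.norm_coe, one_mul]
    exact Real.norm_exp_I_mul_ofReal_sub_one_le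
  -- One of the two intervals of length `r` that end at `θ` lies inside `(0, 2π]`.
  obtain ⟨a, ha⟩ : ∃ a : ℝ, Set.Ioc a (a + r) ⊆
      Circle.exp ⁻¹' Metric.closedBall (Circle.exp θ) r ∩ Set.Ioc 0 (2 * Real.pi) := by
    rcases le_or_gt θ Real.pi with h | h
    · refine ⟨θ, fun s hs => ⟨(hdist s).trans ?_, by linarith [hs.1, hθ.1], by linarith [hs.2]⟩⟩
      rw [abs_le]
      constructor <;> linarith [hs.1, hs.2]
    · refine ⟨θ - r, fun s hs => ⟨(hdist s).trans ?_, by linarith [hs.1], by linarith [hs.2, hθ.2]⟩⟩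
      rw [abs_le]
      constructor <;> linarith [hs.1, hs.2]
  have hball : MeasurableSet (Metric.closedBall (Circle.exp θ) r) :=
    Metric.isClosed_closedBall.measurableSet
  rw [circleLebesgue, measureReal_ennreal_smul_apply, map_measureReal_apply (by fun_prop) hball,
    measureReal_restrict_apply ((by fun_prop : Measurable Circle.exp) hball), ENNReal.toReal_inv,
    ENNReal.toReal_ofReal Real.two_pi_pos.le]
  gcongr
  calc r = volume.real (Set.Ioc a (a + r)) := by simp [measureReal_def, hr.le]
    _ ≤ _ := measureReal_mono ha
        (measure_ne_top_of_subset Set.inter_subset_right measure_Ioc_lt_top.ne)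

/-! ### Differentiation of measures on the circle -/

/-- The circle inherits the Besicovitch covering property from the plane. -/
instance Circle.instHasBesicovitchCovering : HasBesicovitchCovering Circle := by
  obtain ⟨N, τ, hτ, hN⟩ := HasBesicovitchCovering.no_satelliteConfig (α := ℂ)
  exact ⟨N, τ, hτ, ⟨fun a => hN.false
    { c := fun i => (a.c i : ℂ), r := a.r, rpos := a.rpos, h := a.h, hlast := a.hlast,
      inter := a.inter }⟩⟩

/-- A measure whose density with respect to Lebesgue measure vanishes at `ω` is small on the arcs
around `ω` compared with their length. -/
theorem tendsto_measure_closedBall_div_radius {ν : Measure Circle} [IsFiniteMeasure ν] {ω : Circle}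
    (h : Tendsto (fun r => ν (Metric.closedBall ω r) / circleLebesgue (Metric.closedBall ω r))
      (𝓝[>] 0) (𝓝 0)) :
    Tendsto (fun r => ν.real (Metric.closedBall ω r) / r) (𝓝[>] 0) (𝓝 0) := by
  have h1 := ((ENNReal.tendsto_toReal ENNReal.zero_ne_top).comp h).const_mul 9
  simp only [ENNReal.toReal_zero, mul_zero] at h1
  have hmem : Set.Ioo (0 : ℝ) 1 ∈ 𝓝[>] (0 : ℝ) := Ioo_mem_nhdsGT one_pos
  refine squeeze_zero' ?_ ?_ h1
  · filter_upwards [hmem] with r hr using div_nonneg measureReal_nonneg hr.1.le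
  · filter_upwards [hmem] with r hr
    have hup := circleLebesgue_closedBall_le ω hr.1 hr.2
    have hlow := le_circleLebesgue_closedBall ω hr.1 hr.2
    have hpos : 0 < circleLebesgue.real (Metric.closedBall ω r) :=
      lt_of_lt_of_le (mul_pos (inv_pos.2 Real.two_pi_pos) hr.1) hlow
    rw [Function.comp_apply, ENNReal.toReal_div, ← measureReal_def, ← measureReal_def,
      ← mul_div_assoc, div_le_div_iff₀ hr.1 hpos]
    nlinarith [measureReal_nonneg (μ := ν) (s := Metric.closedBall ω r)]

section Singular

variable {μ : Measure Circle} [IsFiniteMeasure μ]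

theorem ae_tendsto_poissonIntegral_zero (hμ : μ ⟂ₘ circleLebesgue) :
    ∀ᵐ ω ∂circleLebesgue, ∀ M, Tendsto
      (fun z : 𝔻 => ∫ ζ : Circle, poissonKernel 0 (z : ℂ) (ζ : ℂ) ∂μ) (stolz ω M) (𝓝 0) := by
  filter_upwards [Besicovitch.ae_tendsto_rnDeriv μ circleLebesgue,
    (Measure.rnDeriv_eq_zero _ _).2 hμ] with ω h1 h2 M
  rw [h2, Pi.zero_apply] at h1
  exact tendsto_poissonIntegral_zero (tendsto_measure_closedBall_div_radius h1) M

theorem ae_tendsto_poissonIntegral_atTop (hμ : μ ⟂ₘ circleLebesgue) :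
    ∀ᵐ ω ∂μ, ∀ M, Tendsto
      (fun z : 𝔻 => ∫ ζ : Circle, poissonKernel 0 (z : ℂ) (ζ : ℂ) ∂μ) (stolz ω M) atTop := by
  filter_upwards [Besicovitch.ae_tendsto_rnDeriv circleLebesgue μ,
    (Measure.rnDeriv_eq_zero _ _).2 hμ.symm] with ω h1 h2 M
  rw [h2, Pi.zero_apply] at h1
  refine tendsto_poissonIntegral_atTop (tendsto_atTop.2 fun K => ?_) M
  set K' := 2 * Real.pi * (|K| + 1)
  have hK' : 0 < K' := by positivity
  have hmem : Set.Ioo (0 : ℝ) 1 ∈ 𝓝[>] (0 : ℝ) := Ioo_mem_nhdsGT one_pos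
  filter_upwards [hmem, h1.eventually_le_const (ENNReal.ofReal_pos.2 (inv_pos.2 hK'))] with r hr hle
  have hlow := le_circleLebesgue_closedBall ω hr.1 hr.2
  rw [ENNReal.div_le_iff_le_mul (Or.inr ENNReal.ofReal_ne_top) (Or.inl (measure_ne_top _ _))] at hle
  have hle' := ENNReal.toReal_mono
    (ENNReal.mul_ne_top ENNReal.ofReal_ne_top (measure_ne_top _ _)) hle
  rw [ENNReal.toReal_mul, ENNReal.toReal_ofReal (inv_pos.2 hK').le, ← measureReal_def,
    ← measureReal_def] at hle'
  have h3 := hlow.trans hle'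
  rw [inv_mul_le_iff₀ Real.two_pi_pos, ← mul_assoc, ← div_eq_mul_inv, div_mul_eq_mul_div,
    le_div_iff₀ hK'] at h3
  rw [le_div_iff₀ hr.1]
  have h4 : r * (|K| + 1) ≤ μ.real (Metric.closedBall ω r) := by
    refine le_of_mul_le_mul_left ?_ Real.two_pi_pos
    calc 2 * Real.pi * (r * (|K| + 1)) = r * K' := by simp only [K']; ring
      _ ≤ _ := h3
  nlinarith [le_abs_self K, hr.1]

end Singular

/-! ### Boundary values in the Hardy space -/

open HardySpace in
/-- A function of the Hardy space is the Poisson integral of the series `∑ aₙ ζⁿ` in `L²`. -/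
theorem integral_poissonKernel_smul_eq (f : HardySpace) (z : 𝔻) :
    ∫ ζ : Circle, poissonKernel 0 (z : ℂ) (ζ : ℂ) •
      (orthonormal_circleMonomial.orthogonalFamily.linearIsometry (coeff f)) ζ ∂circleLebesgue =
      f z := by
  have hsum := orthonormal_circleMonomial.orthogonalFamily.hasSum_linearIsometry (coeff f)
  set F := orthonormal_circleMonomial.orthogonalFamily.linearIsometry (coeff f)
  simp only [LinearIsometry.toSpanSingleton_apply] at hsum
  let P : C(Circle, ℂ) := ⟨fun ζ => (poissonKernel 0 (z : ℂ) (ζ : ℂ) : ℂ),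
    Complex.continuous_ofReal.comp (continuous_poissonKernel_circle z)⟩
  have h1 := (innerSL ℂ (ContinuousMap.toLp 2 circleLebesgue ℂ P)).hasSum hsum
  have hP (n : ℕ) : inner ℂ (ContinuousMap.toLp 2 circleLebesgue ℂ P)
      (circleMonomial circleLebesgue n) = (z : ℂ) ^ n := by
    rw [circleMonomial, ContinuousMap.inner_toLp, ← integral_poissonKernel_smul_pow z n]
    refine integral_congr_ae (Eventually.of_forall fun ζ => ?_)
    simp [P, mul_comm]
  have hF : inner ℂ (ContinuousMap.toLp 2 circleLebesgue ℂ P) F = ∫ ζ : Circle,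
      poissonKernel 0 (z : ℂ) (ζ : ℂ) • F ζ ∂circleLebesgue := by
    rw [L2.inner_def]
    refine integral_congr_ae ?_
    filter_upwards [ContinuousMap.coeFn_toLp (p := 2) (𝕜 := ℂ) circleLebesgue P] with ζ hζ
    rw [hζ]
    simp [P, mul_comm]
  rw [← hF]
  refine h1.unique ?_
  convert! hasSum_coeff f z using 2 with n
  simp [hP]

open HardySpace in
/-- **Fatou's theorem**: a function of the Hardy space has nontangential limits almost everywhere,
which form a function of the same norm. -/
theorem exists_boundary_function (f : HardySpace) : ∃ F : Lp ℂ 2 circleLebesgue, ‖F‖ = ‖f‖ ∧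
    ∀ᵐ ω ∂circleLebesgue, HasNontangentialLimit f ω (F ω) := by
  refine ⟨orthonormal_circleMonomial.orthogonalFamily.linearIsometry (coeff f),
    (LinearIsometry.norm_map _ _).trans (norm_coeff f), ?_⟩
  have hrep := integral_poissonKernel_smul_eq f
  set F := orthonormal_circleMonomial.orthogonalFamily.linearIsometry (coeff f)
  have hFint : Integrable F circleLebesgue := (Lp.memLp F).integrable (by norm_num)
  filter_upwards [(Besicovitch.vitaliFamily circleLebesgue).ae_tendsto_lintegral_enorm_sub_div
    hFint.locallyIntegrable] with ω hω M
  have hω' := hω.comp (Besicovitch.tendsto_filterAt circleLebesgue ω)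
  -- The differences from the boundary value are dominated by the Poisson integral of `|F - F(ω)|`.
  have hdint : Integrable (fun ζ => F ζ - F ω) circleLebesgue := hFint.sub (integrable_const _)
  have hmeas : Measurable fun ζ => ‖F ζ - F ω‖₊ :=
    ((Lp.stronglyMeasurable F).measurable.sub_const _).nnnorm
  let ν : Measure Circle := circleLebesgue.withDensity fun ζ => (‖F ζ - F ω‖₊ : ℝ≥0∞)
  have hfin : IsFiniteMeasure ν := isFiniteMeasure_withDensity hdint.2.ne
  have hν : Tendsto (fun r => ν (Metric.closedBall ω r) /
      circleLebesgue (Metric.closedBall ω r)) (𝓝[>] 0) (𝓝 0) := by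
    refine hω'.congr fun r => ?_
    simp only [Function.comp_apply, ν,
      withDensity_apply _ (Metric.isClosed_closedBall (x := ω) (ε := r)).measurableSet]
    rfl
  rw [tendsto_iff_norm_sub_tendsto_zero]
  refine squeeze_zero (fun _ => norm_nonneg _) (fun z => ?_)
    (tendsto_poissonIntegral_zero (tendsto_measure_closedBall_div_radius hν) M)
  have hbd : ∃ C, ∀ ζ : Circle, ‖poissonKernel 0 (z : ℂ) (ζ : ℂ)‖ ≤ C := by
    obtain ⟨C, hC⟩ := isCompact_univ.exists_bound_of_continuousOn
      (continuous_poissonKernel_circle z).continuousOn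
    exact ⟨C, fun ζ => hC ζ trivial⟩
  obtain ⟨C, hC⟩ := hbd
  have hsub : f z - F ω = ∫ ζ : Circle,
      poissonKernel 0 (z : ℂ) (ζ : ℂ) • (F ζ - F ω) ∂circleLebesgue := by
    have hc : ∫ ζ : Circle, poissonKernel 0 (z : ℂ) (ζ : ℂ) • F ω ∂circleLebesgue = F ω := by
      rw [integral_smul_const, integral_poissonKernel_circleLebesgue, one_smul]
    simp only [smul_sub]
    rw [integral_sub, hc, hrep]
    · refine (hFint.norm.const_mul C).mono' ((continuous_poissonKernel_circle
        z).aestronglyMeasurable.smul hFint.1) (Eventually.of_forall fun ζ => ?_)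
      rw [norm_smul]
      gcongr
      exact hC ζ
    · exact (integrable_poissonKernel_circle z circleLebesgue).smul_const _
  rw [hsub]
  refine (norm_integral_le_integral_norm _).trans_eq ?_
  rw [integral_withDensity_eq_integral_smul hmeas]
  refine integral_congr_ae (Eventually.of_forall fun ζ => ?_)
  change ‖poissonKernel 0 (z : ℂ) (ζ : ℂ) • (F ζ - F ω)‖ =
    ‖F ζ - F ω‖ * poissonKernel 0 (z : ℂ) (ζ : ℂ)
  rw [norm_smul, Real.norm_of_nonneg (poissonKernel_circle_nonneg z ζ), mul_comm]

/-! ### Boundary behaviour of the symbol -/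

section Boundary

variable (μ : Measure Circle) [IsProbabilityMeasure μ]

theorem re_herglotz (z : 𝔻) :
    (herglotz μ z).re = ∫ ζ : Circle, poissonKernel 0 (z : ℂ) (ζ : ℂ) ∂μ := by
  have hint : Integrable (fun ζ : Circle => ((ζ : ℂ) + z) / ((ζ : ℂ) - z)) μ := by
    refine Continuous.integrable_of_hasCompactSupport ?_ (HasCompactSupport.of_compactSpace _)
    exact (by fun_prop : Continuous fun ζ : Circle => (ζ : ℂ) + z).div (by fun_prop)
      fun ζ => norm_pos_iff.1 (norm_circle_sub_pos z ζ)
  rw [herglotz, ← Complex.reCLM_apply, ← Complex.reCLM.integral_comp_comm hint]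
  refine integral_congr_ae (Eventually.of_forall fun ζ => ?_)
  simp [poissonKernel_eq_re_herglotzRieszKernel, herglotzRieszKernel_def]

theorem one_sub_clarkFunction (z : 𝔻) : 1 - clarkFunction μ z = 2 / (herglotz μ z + 1) := by
  have := herglotz_add_one_ne_zero μ z
  rw [clarkFunction]
  field_simp
  ring

theorem one_sub_norm_clarkFunction_sq (z : 𝔻) :
    1 - ‖clarkFunction μ z‖ ^ 2 = (herglotz μ z).re * ‖1 - clarkFunction μ z‖ ^ 2 := by
  have h0 := herglotz_add_one_ne_zero μ z
  have h1 : ‖herglotz μ z + 1‖ ^ 2 ≠ 0 := pow_ne_zero 2 (norm_ne_zero_iff.2 h0)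
  rw [one_sub_clarkFunction, clarkFunction, norm_div, norm_div, div_pow, div_pow, eq_comm,
    ← mul_div_assoc, div_eq_iff h1, sub_mul, div_mul_cancel₀ _ h1, Complex.sq_norm (_ + 1),
    Complex.sq_norm (_ - 1)]
  simp [Complex.normSq_apply]
  ring

variable {μ}

theorem ae_tendsto_clarkFunction_one (hμ : μ ⟂ₘ circleLebesgue) :
    ∀ᵐ ω ∂μ, HasNontangentialLimit (clarkFunction μ) ω 1 := by
  filter_upwards [ae_tendsto_poissonIntegral_atTop hμ] with ω hω M
  rw [tendsto_iff_norm_sub_tendsto_zero]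
  have h1 := tendsto_atTop_add_const_right _ 1 (hω M)
  refine squeeze_zero' (Eventually.of_forall fun _ => norm_nonneg _) ?_ (h1.const_div_atTop 2)
  filter_upwards [h1.eventually_gt_atTop 0] with z hz
  rw [norm_sub_rev, one_sub_clarkFunction, norm_div, Complex.norm_ofNat]
  gcongr
  rw [← re_herglotz]
  simpa using Complex.re_le_norm (herglotz μ z + 1)

theorem norm_eq_one_of_hasNontangentialLimit {ω : Circle} {c : ℂ}
    (h0 : ∀ M, Tendsto (fun z : 𝔻 => ∫ ζ : Circle, poissonKernel 0 (z : ℂ) (ζ : ℂ) ∂μ)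
      (stolz ω M) (𝓝 0))
    (hc : HasNontangentialLimit (clarkFunction μ) ω c) : ‖c‖ = 1 := by
  have := stolz_two_neBot ω
  have hlim : Tendsto (clarkFunction μ) (stolz ω 2) (𝓝 c) := hc 2
  have h1 := (hlim.norm.pow 2).const_sub 1
  have h2 := (h0 2).mul ((hlim.const_sub 1).norm.pow 2)
  simp only [one_sub_norm_clarkFunction_sq, re_herglotz] at h1
  have h3 := tendsto_nhds_unique h1 h2
  rw [zero_mul, sub_eq_zero] at h3
  exact (pow_eq_one_iff_of_nonneg (norm_nonneg _) two_ne_zero).1 h3.symm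

theorem norm_clarkSymbol (hμ : μ ⟂ₘ circleLebesgue) : ‖clarkSymbol μ‖ = 1 := by
  obtain ⟨F, hF, hlim⟩ := exists_boundary_function (clarkSymbol μ)
  have h1 : ∀ᵐ ω ∂circleLebesgue, ‖F ω‖ = ‖(1 : ℝ)‖ := by
    filter_upwards [hlim, ae_tendsto_poissonIntegral_zero hμ] with ω h1 h2
    rw [norm_one]
    refine norm_eq_one_of_hasNontangentialLimit h2 ?_
    rwa [(funext (clarkFunction_eq_clarkSymbol μ) : clarkFunction μ = (clarkSymbol μ).1)]
  rw [← hF, Lp.norm_def, eLpNorm_congr_norm_ae h1, eLpNorm_const _ (by norm_num) (NeZero.ne _)]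
  simp

theorem isInner_clarkFunction (hμ : μ ⟂ₘ circleLebesgue) : IsInner (clarkFunction μ) := by
  refine ⟨clarkFunction_mem_hardySubmodule μ, ?_⟩
  obtain ⟨F, hF, hlim⟩ := exists_boundary_function (clarkSymbol μ)
  filter_upwards [hlim, ae_tendsto_poissonIntegral_zero hμ] with ω h1 h2
  rw [← (funext (clarkFunction_eq_clarkSymbol μ) : clarkFunction μ = (clarkSymbol μ).1)] at h1
  exact ⟨F ω, norm_eq_one_of_hasNontangentialLimit h2 h1, h1⟩

/-- The Clark transform of `x` has the nontangential boundary values `x(ζ)`, if `x` is a linear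
combination of monomials. -/
theorem ae_hasNontangentialLimit_clarkTransform (hμ : μ ⟂ₘ circleLebesgue) {x : Lp ℂ 2 μ}
    (hx : x ∈ Submodule.span ℂ (Set.range (circleMonomial μ))) :
    ∀ᵐ ζ ∂μ, HasNontangentialLimit
      (clarkTransform (coordMul μ) (norm_circleMonomial_zero μ) x) ζ (x ζ) := by
  induction hx using Submodule.span_induction with
  | mem x hx =>
    obtain ⟨n, rfl⟩ := hx
    filter_upwards [ae_tendsto_clarkFunction_one hμ, ContinuousMap.coeFn_toLp (p := 2) (𝕜 := ℂ) μ
      ⟨fun ζ : Circle => (ζ : ℂ) ^ n, by fun_prop⟩] with ζ h1 h2 M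
    have h3 : circleMonomial μ n ζ = (ζ : ℂ) ^ n := h2
    rw [h3]
    exact tendsto_clarkTransform_stationary _ rfl circleMonomial_succ
      (clarkFunction_eq_clarkSymbol μ) (tendsto_coe_stolz ζ M) (h1 M) n
  | zero =>
    filter_upwards [Lp.coeFn_zero ℂ 2 μ] with ζ h M
    rw [h, map_zero]
    exact tendsto_const_nhds
  | add x y _ _ hx hy =>
    filter_upwards [hx, hy, Lp.coeFn_add x y] with ζ h1 h2 h3 M
    rw [h3, map_add]
    exact (h1 M).add (h2 M)
  | smul c x _ hx =>
    filter_upwards [hx, Lp.coeFn_smul c x] with ζ h1 h2 M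
    rw [h2, map_smul]
    exact (h1 M).const_mul c

end Boundary

end

theorem mainTheorem1 (μ : Measure Circle) [IsProbabilityMeasure μ]
    (hμ : μ ⟂ₘ circleLebesgue) :
    IsInner (clarkFunction μ) ∧ clarkFunction μ 0 = 0 ∧
      IsEffective (circleMonomial μ) ∧
      IsParsevalFrame (kaczmarzFrame (circleMonomial μ)) ∧
      IsParsevalFrame (modelFrame (clarkFunction μ)) ∧
      ∀ n : ℕ, ∀ᵐ ζ ∂μ, HasNontangentialLimit
        (modelFrame (clarkFunction μ) n : HardySpace) ζ
        (kaczmarzFrame (circleMonomial μ) n ζ) := by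
  have hv := norm_circleMonomial_zero μ
  have hM := kaczmarzSubmodule_eq_top μ (norm_clarkSymbol hμ)
  refine ⟨isInner_clarkFunction hμ, ?_, isEffective_stationary hv rfl circleMonomial_succ hM,
    isParsevalFrame_kaczmarzFrame hv rfl circleMonomial_succ hM,
    isParsevalFrame_modelFrame _, fun n => ?_⟩
  · rw [clarkFunction_eq_clarkSymbol, clarkSymbol, HardySpace.shift_apply]
    simp
  · rw [modelFrame_eq_clarkTransform hv rfl circleMonomial_succ hM
      (clarkFunction_eq_clarkSymbol μ) n]
    exact ae_hasNontangentialLimit_clarkTransform hμ (kaczmarzFrame_mem_span _ n)
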